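/- Consider a quantum particle of reduced mass $\mu>0$ in a spherical well of radius $R>0$ and depth $V_0>0$ with a $\delta$-$\delta'$ interaction at its edge. For angular momentum $\ell\in\mathbb{N}_0$ the reduced radial Hamiltonian is $$-\frac{d^2}{dr^2}+\frac{\ell(\ell+1)}{r^2}+\frac{2\mu V_0}{\hbar^2}\bigl(\theta(r-R)-1\bigr)+\alpha_\ell\,\delta(r-R)+\beta\,\delta'(r-R)\qquad(r>0),$$ where $\alpha_\ell,\beta\in\mathbb{R}$, $\beta\neq\pm2$; the coupling $\alpha_\ell$ may depend on $\ell$. A bound state with angular momentum $\ell$ is a nonzero $u\in L^2(0,\infty)$ with $u(0^+)=0$ that, for some energy $E<0$, solves $$-u''+\frac{\ell(\ell+1)}{r^2}u+\frac{2\mu}{\hbar^2}\bigl(V_0(\theta(r-R)-1)-E\bigr)u=0$$ on $(0,R)$ and on $(R,\infty)$ and satisfies $$u(R^+)=\tfrac{2+\beta}{2-\beta}\,u(R^-),\qquad u'(R^+)=\tfrac{4\alpha_\ell}{4-\beta^2}\,u(R^-)+\tfrac{2-\beta}{2+\beta}\,u'(R^-).$$ Let $v_0=\sqrt{2\mu R^2V_0/\hbar^2}$,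 $w_\ell=4R\alpha_\ell$, let $j_{\nu,s}$ be the $s$-th positive zero of the Bessel function $J_\nu$, and let $$\varphi_\ell(\chi)=\frac{\chi J_{\ell+3/2}(\chi)}{J_{\ell+1/2}(\chi)},\qquad \hat\varphi_\ell(\sigma)=\frac{(2+\beta)^2}{(2-\beta)^2}\,\frac{\sigma K_{\ell+3/2}(\sigma)}{K_{\ell+1/2}(\sigma)}-\frac{8\beta(\ell+1)}{(2-\beta)^2}+\frac{w_\ell}{(2-\beta)^2}.$$ Then the limits $\hat\varphi_\ell(0^+)=\lim_{\sigma\to0^+}\hat\varphi_\ell(\sigma)$ exist. Let $S$ be the set of all $\ell\in\mathbb{N}_0$ such that $j_{\ell+1/2,1}<v_0$ or $\varphi_\ell(v_0)>\hat\varphi_\ell(0^+)$, where those $\ell$ for which $v_0$ is one of the zeros $j_{\ell+1/2,s}$, $s\ge1$ (so that $\varphi_\ell(v_0)$ is undefined), also belong to $S$. (a) If $S$ has a maximum $\ell_{\max}$, then there are no bound states with angular momentum $\ell>\ell_{\max}$; if $S=\emptyset$, there are no bound states at all. (b) Suppose that for some $\delta>0$ one has $(\beta-2)^2+2\ell(\beta^2+4)+w_\ell\ge\delta$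 for all sufficiently large $\ell$ (this holds in particular if $\alpha_\ell$ does not depend on $\ell$). If $S\ne\emptyset$, then $\ell_{\max}=\max S$ exists. (c) If $v_0=j_{\ell_0+1/2,s_0}$ for some $\ell_0\in\mathbb{N}_0$ and $s_0\ge1$, then there is at least one bound state with angular momentum $\ell_0$. If moreover $s_0\ge2$ or $\hat\varphi_{\ell_0}(v_0)>0$, there is one with energy $E\in(-V_0,0)$. -/

import Mathlib

open MeasureTheory Set Filter Topology

/-- Bessel function of the first kind `J_ν(x)`, by its power series (used for real `ν ≥ 0`
and `x > 0`). -/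
noncomputable def besselJ (ν x : ℝ) : ℝ :=
  ∑' m : ℕ, (-1 : ℝ) ^ m / ((m.factorial : ℝ) * Real.Gamma ((m : ℝ) + ν + 1))
    * (x / 2) ^ (2 * (m : ℝ) + ν)

/-- Modified Bessel function of the second kind `K_ν(x)`, by its integral representation
`∫₀^∞ exp (-x cosh t) cosh (ν t) dt` (used for `x > 0`). -/
noncomputable def besselK (ν x : ℝ) : ℝ :=
  ∫ t in Ioi (0 : ℝ), Real.exp (-x * Real.cosh t) * Real.cosh (ν * t)

/-- `besselZero ν s` is `j_{ν,s}`, the `s`-th strictly positive zero of `J_ν`, with the convention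
`j_{ν,0} = 0`. (`J_ν` has infinitely many positive zeros, and they are isolated and do not
accumulate at `0`, so the infimum is a minimum.) -/
noncomputable def besselZero (ν : ℝ) : ℕ → ℝ
  | 0 => 0
  | s + 1 => sInf {x : ℝ | besselZero ν s < x ∧ besselJ ν x = 0}

/-- Parameters of a quantum particle of (reduced) mass `mu` in a spherical well of radius `R` and
depth `V0`, with a `δ`-`δ'` interaction at the edge: the radial Hamiltonian contains
`alpha ℓ • δ(r - R) + beta • δ'(r - R)`, in units of `ħ² / (2 μ)`. The strength of the `δ` term may
depend on the angular momentum `ℓ` (as it does for a spin-orbit coupling, for each of the choices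
`j = ℓ ± 1/2`); a pure `δ`-`δ'` interaction has `alpha` constant. -/
structure DeltaWell where
  hbar : ℝ
  mu : ℝ
  R : ℝ
  V0 : ℝ
  alpha : ℕ → ℝ
  beta : ℝ
  hbar_pos : 0 < hbar
  mu_pos : 0 < mu
  R_pos : 0 < R
  V0_pos : 0 < V0

namespace DeltaWell

/-- The dimensionless depth `v₀ = √(2 μ R² V₀ / ħ²)`. -/
noncomputable def v0 (p : DeltaWell) : ℝ :=
  Real.sqrt (2 * p.mu * p.R ^ 2 * p.V0 / p.hbar ^ 2)

/-- The dimensionless strength `w_ℓ = 4 R α_ℓ` of the `δ` term. -/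
noncomputable def w (p : DeltaWell) (l : ℕ) : ℝ := 4 * p.R * p.alpha l

/-- The regular potential `V₀ (θ(r - R) - 1)` of the well: `-V₀` for `r < R`, `0` for `r > R`. -/
noncomputable def wellPotential (p : DeltaWell) (r : ℝ) : ℝ := if r < p.R then -p.V0 else 0

/-- `u` is the reduced radial wave function of a bound state with angular momentum `l` and energy
`E < 0`: it is a nonzero square integrable function on `(0, ∞)` that vanishes at the origin, solves
`-u'' + (l (l + 1) / r² + (2 μ / ħ²) (V(r) - E)) u = 0` on `(0, R)` and on `(R, ∞)`, and fulfils at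
`r = R` the matching conditions that define the `δ`-`δ'` interaction. -/
structure IsBoundState (p : DeltaWell) (l : ℕ) (E : ℝ) (u : ℝ → ℂ) : Prop where
  energy_neg : E < 0
  nonzero : ∃ r : ℝ, 0 < r ∧ r ≠ p.R ∧ u r ≠ 0
  square_integrable : MemLp u 2 (volume.restrict (Ioi (0 : ℝ)))
  origin : Tendsto u (𝓝[>] 0) (𝓝 0)
  differentiable : ∀ r : ℝ, 0 < r → r ≠ p.R → DifferentiableAt ℝ u r
  schrodinger : ∀ r : ℝ, 0 < r → r ≠ p.R →
    HasDerivAt (deriv u)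
      ((((l : ℝ) * ((l : ℝ) + 1) / r ^ 2
        + 2 * p.mu / p.hbar ^ 2 * (p.wellPotential r - E) : ℝ) : ℂ) * u r) r
  matching : ∃ um dum up dup : ℂ,
    Tendsto u (𝓝[<] p.R) (𝓝 um) ∧ Tendsto (deriv u) (𝓝[<] p.R) (𝓝 dum) ∧
    Tendsto u (𝓝[>] p.R) (𝓝 up) ∧ Tendsto (deriv u) (𝓝[>] p.R) (𝓝 dup) ∧
    up = (((2 + p.beta) / (2 - p.beta) : ℝ) : ℂ) * um ∧
    dup = ((4 * p.alpha l / (4 - p.beta ^ 2) : ℝ) : ℂ) * um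
      + (((2 - p.beta) / (2 + p.beta) : ℝ) : ℂ) * dum

/-- Left-hand side of the secular equation, `φ_ℓ(χ) = χ J_{ℓ+3/2}(χ) / J_{ℓ+1/2}(χ)`. -/
noncomputable def phi (l : ℕ) (χ : ℝ) : ℝ :=
  χ * besselJ ((l : ℝ) + 3 / 2) χ / besselJ ((l : ℝ) + 1 / 2) χ

/-- Right-hand side of the secular equation,
`φ̂_ℓ(σ) = ((2+β)² σ K_{ℓ+3/2}(σ) / K_{ℓ+1/2}(σ) - 8 β (ℓ+1) + w_ℓ) / (2-β)²`. -/
noncomputable def phiHat (p : DeltaWell) (l : ℕ) (σ : ℝ) : ℝ :=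
  (2 + p.beta) ^ 2 / (2 - p.beta) ^ 2
      * (σ * besselK ((l : ℝ) + 3 / 2) σ / besselK ((l : ℝ) + 1 / 2) σ)
    - 8 * p.beta * ((l : ℝ) + 1) / (2 - p.beta) ^ 2
    + p.w l / (2 - p.beta) ^ 2

/-- `φ̂_ℓ(0⁺)`, the limit of `φ̂_ℓ` at `0` from the right. -/
noncomputable def phiHatZero (p : DeltaWell) (l : ℕ) : ℝ := Function.rightLim (p.phiHat l) 0

/-- The set of angular momenta whose maximum is `ℓ_max`: those `ℓ` with `j_{ℓ+1/2,1} < v₀` or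
`φ_ℓ(v₀) > φ̂_ℓ(0⁺)`. Where `v₀` is a zero of `J_{ℓ+1/2}`, so that `φ_ℓ(v₀)` cannot be evaluated,
`ℓ` is counted as a member. -/
def admissible (p : DeltaWell) : Set ℕ :=
  {l : ℕ | besselZero ((l : ℝ) + 1 / 2) 1 < p.v0 ∨
    (∃ s : ℕ, 1 ≤ s ∧ p.v0 = besselZero ((l : ℝ) + 1 / 2) s) ∨
    phi l p.v0 > p.phiHatZero l}

end DeltaWell

/-! Everything about `J_ν` is read off the power series of `A_ν`: `A_ν' = -A_{ν+1} / 4`, a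
three-term recurrence, simple zeros, and dominance of the leading term when `ν` is large. The
function `K_ν` is handled through its integral.

Absence of bound states is a Picone comparison with zero energy. Put `c = -2μE/ħ² > 0`. If `g` is
the logarithmic derivative of a zero-energy solution, then `u u' - u² g` has derivative `(u' - u g)²
+ c u²`, so it increases. On `(0, R)` take the regular solution, which has no zeros there when `v₀ <
j_{ℓ+1/2,1}`; since `u` vanishes at `0`, the limit at `R⁻` is nonnegative
(`picone_nonneg_of_tendsto_zero`). On `(R, ∞)` take `r ^ (-ℓ)`; square integrability makes the limit
at `R⁺` nonpositive (`picone_nonpos_of_integrable_sq`). By the matching conditions, outer minus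
inner limit is `u(R⁻)² (φ̂_ℓ(0⁺) - φ_ℓ(v₀)) / R`. If this is nonnegative, both limits vanish and `u
= 0`.

For (b), leading-term dominance pushes the zeros of `J_{ℓ+1/2}` beyond `v₀` and gives `φ_ℓ(v₀) → 0`,
while `φ̂_ℓ(0⁺) ≥ δ / (2 - β)²`.

For (c), a zero `z < v₀²` of the continuous function `secular` gives a bound state of energy `ħ² z /
(2μR²) - V₀`. At a zero of `A_ν`, the sign of `secular` is governed by `A_{ν+1} = -4 A_ν'`, which
alternates between consecutive zeros; the first zero is compared with a point `z ≤ 0`. -/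

/-! ### Bessel functions of the first kind and their zeros -/

/-- The entire function `A` with `J_ν(x) = (x / 2) ^ ν * A_ν(x ^ 2)`. -/
noncomputable def besselEntire (ν z : ℝ) : ℝ :=
  ∑' m : ℕ, (-z / 4) ^ m / ((m.factorial : ℝ) * Real.Gamma ((m : ℝ) + ν + 1))

theorem Gamma_mul_pow_le_Gamma_add_natCast {ν : ℝ} (hν : 0 ≤ ν) (m : ℕ) :
    Real.Gamma (ν + 1) * (ν + 1) ^ m ≤ Real.Gamma ((m : ℝ) + ν + 1) := by
  induction m with
  | zero => simp
  | succ m ih =>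
    have hm : (0 : ℝ) ≤ m := m.cast_nonneg
    have h : Real.Gamma (((m + 1 : ℕ) : ℝ) + ν + 1)
        = ((m : ℝ) + ν + 1) * Real.Gamma ((m : ℝ) + ν + 1) := by
      rw [← Real.Gamma_add_one (by positivity)]
      push_cast
      ring_nf
    rw [h, pow_succ]
    have h0 : 0 < Real.Gamma ((m : ℝ) + ν + 1) := Real.Gamma_pos_of_pos (by positivity)
    calc Real.Gamma (ν + 1) * ((ν + 1) ^ m * (ν + 1))
        = (ν + 1) * (Real.Gamma (ν + 1) * (ν + 1) ^ m) := by ring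
      _ ≤ (ν + 1) * Real.Gamma ((m : ℝ) + ν + 1) := by gcongr
      _ ≤ ((m : ℝ) + ν + 1) * Real.Gamma ((m : ℝ) + ν + 1) := by gcongr; linarith

/-- The majorant is an exponential series whose argument tends to `0` as `ν → ∞`. It therefore gives
convergence and also dominance of the leading term at large order. -/
theorem abs_besselEntire_term_le {ν : ℝ} (hν : 0 ≤ ν) (z : ℝ) (m : ℕ) :
    |(-z / 4) ^ m / ((m.factorial : ℝ) * Real.Gamma ((m : ℝ) + ν + 1))|
      ≤ (|z| / (4 * (ν + 1))) ^ m / (m.factorial : ℝ) / Real.Gamma (ν + 1) := by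
  have h0 : 0 < Real.Gamma (ν + 1) := Real.Gamma_pos_of_pos (by positivity)
  have h1 := Gamma_mul_pow_le_Gamma_add_natCast hν m
  have h2 : 0 < Real.Gamma (ν + 1) * (ν + 1) ^ m := by positivity
  have hf : (0 : ℝ) < m.factorial := by positivity
  have h3 : |(-z / 4) ^ m| = (|z| / 4) ^ m := by
    rw [abs_pow, abs_div, abs_neg]; norm_num
  rw [abs_div, h3, abs_of_pos (mul_pos hf (h2.trans_le h1))]
  calc (|z| / 4) ^ m / ((m.factorial : ℝ) * Real.Gamma ((m : ℝ) + ν + 1))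
      ≤ (|z| / 4) ^ m / ((m.factorial : ℝ) * (Real.Gamma (ν + 1) * (ν + 1) ^ m)) := by gcongr
    _ = _ := by
      rw [← div_div |z| 4 (ν + 1), div_pow (|z| / 4) (ν + 1)]
      field_simp

theorem hasSum_exp (x : ℝ) : HasSum (fun m : ℕ => x ^ m / (m.factorial : ℝ)) (Real.exp x) := by
  rw [Real.exp_eq_exp_ℝ]
  exact NormedSpace.expSeries_div_hasSum_exp x

theorem hasSum_besselEntire {ν : ℝ} (hν : 0 ≤ ν) (z : ℝ) :
    HasSum (fun m : ℕ => (-z / 4) ^ m / ((m.factorial : ℝ) * Real.Gamma ((m : ℝ) + ν + 1)))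
      (besselEntire ν z) :=
  (Summable.of_norm_bounded ((hasSum_exp _).summable.div_const _)
    (abs_besselEntire_term_le hν z)).hasSum

theorem besselEntire_zero {ν : ℝ} (hν : 0 ≤ ν) :
    besselEntire ν 0 = 1 / Real.Gamma (ν + 1) := by
  refine (hasSum_besselEntire hν 0).unique ?_
  have := hasSum_single (f := fun m : ℕ =>
    (-0 / 4 : ℝ) ^ m / ((m.factorial : ℝ) * Real.Gamma ((m : ℝ) + ν + 1))) 0
    (fun m hm => by simp [hm])
  simpa using this

theorem abs_besselEntire_sub_le {ν : ℝ} (hν : 0 ≤ ν) (z : ℝ) :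
    |besselEntire ν z - 1 / Real.Gamma (ν + 1)|
      ≤ (Real.exp (|z| / (4 * (ν + 1))) - 1) / Real.Gamma (ν + 1) := by
  have h1 := (hasSum_nat_add_iff' 1).2 (hasSum_besselEntire hν z)
  have h2 := ((hasSum_nat_add_iff' 1).2 (hasSum_exp (|z| / (4 * (ν + 1))))).div_const
    (Real.Gamma (ν + 1))
  simp only [Finset.range_one, Finset.sum_singleton, pow_zero, Nat.factorial_zero, Nat.cast_one,
    Nat.cast_zero, zero_add, one_mul, div_one] at h1 h2
  rw [← h1.tsum_eq, ← Real.norm_eq_abs]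
  exact tsum_of_norm_bounded h2 fun m => abs_besselEntire_term_le hν z (m + 1)

theorem besselEntire_pos_of_exp_lt_two {ν z : ℝ} (hν : 0 ≤ ν)
    (h : Real.exp (|z| / (4 * (ν + 1))) < 2) : 0 < besselEntire ν z := by
  have h0 : 0 < Real.Gamma (ν + 1) := Real.Gamma_pos_of_pos (by positivity)
  have h1 := (abs_le.1 (abs_besselEntire_sub_le hν z)).1
  have h2 : (Real.exp (|z| / (4 * (ν + 1))) - 1) / Real.Gamma (ν + 1) < 1 / Real.Gamma (ν + 1) := by
    gcongr; linarith
  linarith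

/-- Negative `z` corresponds to energies below the bottom of the well, where all terms of the series
are nonnegative. -/
theorem besselEntire_pos_of_nonpos {ν z : ℝ} (hν : 0 ≤ ν) (hz : z ≤ 0) :
    0 < besselEntire ν z := by
  have hG : ∀ m : ℕ, 0 < Real.Gamma ((m : ℝ) + ν + 1) :=
    fun m => Real.Gamma_pos_of_pos (by positivity)
  have hz' : 0 ≤ -z / 4 := by linarith
  refine (hasSum_besselEntire hν z).summable.tsum_pos (fun m => ?_) 0 ?_
  · have := hG m
    positivity
  · have := hG 0
    simp only [pow_zero]
    positivity

theorem tendsto_exp_div_natCast (c ν : ℝ) :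
    Tendsto (fun n : ℕ => Real.exp (c / (4 * (ν + n + 1)))) atTop (𝓝 1) := by
  have h : Tendsto (fun n : ℕ => 4 * (ν + (n : ℝ) + 1)) atTop atTop :=
    (tendsto_atTop_add_const_right _ _
      (tendsto_atTop_add_const_left _ _ tendsto_natCast_atTop_atTop)).const_mul_atTop (by norm_num)
  simpa [Function.comp_def] using (Real.continuous_exp.tendsto _).comp (h.const_div_atTop c)

theorem eventually_besselEntire_pos {ν : ℝ} (hν : 0 ≤ ν) (z : ℝ) :
    ∀ᶠ n : ℕ in atTop, 0 < besselEntire (ν + n) z := by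
  filter_upwards [(tendsto_exp_div_natCast |z| ν).eventually (gt_mem_nhds one_lt_two)] with n hn
  exact besselEntire_pos_of_exp_lt_two (by positivity) hn

theorem hasDerivAt_besselEntire {ν : ℝ} (hν : 0 ≤ ν) (z : ℝ) :
    HasDerivAt (besselEntire ν) (-(1 / 4) * besselEntire (ν + 1) z) z := by
  set M := |z| + 1
  have hM : 0 < M := by positivity
  have hG : ∀ m : ℕ, 0 < Real.Gamma ((m : ℝ) + ν + 1) :=
    fun m => Real.Gamma_pos_of_pos (by positivity)
  let g : ℕ → ℝ → ℝ := fun m y =>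
    (-y / 4) ^ m / ((m.factorial : ℝ) * Real.Gamma ((m : ℝ) + ν + 1))
  let g' : ℕ → ℝ → ℝ := fun m y =>
    (m * (-y / 4) ^ (m - 1) * (-1 / 4)) / ((m.factorial : ℝ) * Real.Gamma ((m : ℝ) + ν + 1))
  have hg : ∀ m y, HasDerivAt (g m) (g' m y) y := fun m y =>
    ((((hasDerivAt_id y).neg.div_const 4).pow m).div_const _)
  have hshift : ∀ m y, g' (m + 1) y = -(1 / 4) * ((-y / 4) ^ m /
      ((m.factorial : ℝ) * Real.Gamma ((m : ℝ) + (ν + 1) + 1))) := by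
    intro m y
    have : Real.Gamma (((m + 1 : ℕ) : ℝ) + ν + 1) = Real.Gamma ((m : ℝ) + (ν + 1) + 1) := by
      push_cast; ring_nf
    simp only [g', this, Nat.factorial_succ, Nat.add_sub_cancel]
    have h1 : (m.factorial : ℝ) ≠ 0 := by positivity
    have h2 : ((m : ℝ) + 1) ≠ 0 := by positivity
    push_cast
    field_simp
  -- At `m = 0` the truncated `m - 1` gives a positive value, harmless because `g' 0` vanishes.
  let b : ℕ → ℝ := fun m => (M / (4 * (ν + 1 + 1))) ^ (m - 1) / ((m - 1).factorial : ℝ)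
    / Real.Gamma (ν + 1 + 1)
  have hb : Summable b := by
    rw [← summable_nat_add_iff 1]
    exact (hasSum_exp _).summable.div_const _
  have hG1 : 0 < Real.Gamma (ν + 1 + 1) := Real.Gamma_pos_of_pos (by positivity)
  have hbound : ∀ m y, y ∈ Metric.ball (0 : ℝ) M → ‖g' m y‖ ≤ b m := by
    intro m y hy
    rcases m with _ | m
    · simp only [g', b, CharP.cast_eq_zero, zero_mul, zero_div, norm_zero]
      positivity
    · rw [hshift, norm_mul]
      have hy' : |y| ≤ M := by simpa using (mem_ball_zero_iff.1 hy).le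
      have h1 := abs_besselEntire_term_le (ν := ν + 1) (by positivity) y m
      have h2 : (|y| / (4 * (ν + 1 + 1))) ^ m / (m.factorial : ℝ) / Real.Gamma (ν + 1 + 1)
          ≤ b (m + 1) := by
        simp only [b, Nat.add_sub_cancel]
        gcongr
      have h3 := h1.trans h2
      rw [← Real.norm_eq_abs] at h3
      have h4 : ‖(-(1 / 4) : ℝ)‖ ≤ 1 := by norm_num
      calc _ ≤ 1 * b (m + 1) := mul_le_mul h4 h3 (norm_nonneg _) zero_le_one
        _ = _ := one_mul _
  have hz : z ∈ Metric.ball (0 : ℝ) M := by simp [M]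
  have h := hasDerivAt_tsum_of_isPreconnected hb Metric.isOpen_ball
    (convex_ball (0 : ℝ) M).isPreconnected (fun m y _ => hg m y) hbound hz
    (hasSum_besselEntire hν z).summable hz
  have h5 : HasSum (fun m => g' m z) (-(1 / 4) * besselEntire (ν + 1) z) := by
    refine (hasSum_nat_add_iff' 1).1 ?_
    simp only [hshift, Finset.range_one, Finset.sum_singleton]
    rw [show g' 0 z = 0 by simp [g'], sub_zero]
    exact (hasSum_besselEntire (ν := ν + 1) (by positivity) z).mul_left (-(1 / 4))
  exact h5.tsum_eq ▸ h

theorem continuous_besselEntire {ν : ℝ} (hν : 0 ≤ ν) : Continuous (besselEntire ν) :=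
  continuous_iff_continuousAt.2 fun z => (hasDerivAt_besselEntire hν z).continuousAt

/-- Write `1 / Γ(m+ν+1) = ((ν+1) + m) / Γ(m+ν+2)`. The summand `ν + 1` gives `A_{ν+1}`, and the
summand `m`, after an index shift, gives `A_{ν+2}`. -/
theorem besselEntire_recurrence {ν : ℝ} (hν : 0 ≤ ν) (z : ℝ) :
    besselEntire ν z
      = (ν + 1) * besselEntire (ν + 1) z - z / 4 * besselEntire (ν + 1 + 1) z := by
  have h1 := (hasSum_besselEntire (ν := ν + 1) (by positivity) z).mul_left (ν + 1)
  have h2 := (hasSum_besselEntire (ν := ν + 1 + 1) (by positivity) z).mul_left (-z / 4)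
  have h3 : HasSum (fun m : ℕ => (m : ℝ) * ((-z / 4) ^ m / ((m.factorial : ℝ) *
      Real.Gamma ((m : ℝ) + (ν + 1) + 1)))) (-z / 4 * besselEntire (ν + 1 + 1) z) := by
    refine (hasSum_nat_add_iff' 1).1 ?_
    simp only [Finset.range_one, Finset.sum_singleton, CharP.cast_eq_zero, zero_mul, sub_zero]
    convert! h2 using 2 with m
    have hp : (0 : ℝ) < Real.Gamma ((m : ℝ) + (ν + 1 + 1) + 1) :=
      Real.Gamma_pos_of_pos (by positivity)
    rw [show ((m + 1 : ℕ) : ℝ) + (ν + 1) + 1 = (m : ℝ) + (ν + 1 + 1) + 1 by push_cast; ring,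
      Nat.factorial_succ]
    push_cast
    field_simp
    ring
  refine (hasSum_besselEntire hν z).unique ?_
  have h4 := h1.add h3
  convert! h4 using 1
  · funext m
    have hp : (0 : ℝ) < (m : ℝ) + ν + 1 := by positivity
    have h5 : Real.Gamma ((m : ℝ) + (ν + 1) + 1)
        = ((m : ℝ) + ν + 1) * Real.Gamma ((m : ℝ) + ν + 1) := by
      rw [← Real.Gamma_add_one hp.ne']; ring_nf
    have h6 : 0 < Real.Gamma ((m : ℝ) + ν + 1) := Real.Gamma_pos_of_pos hp
    rw [h5]
    field_simp
    ring
  · ring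

/-- `A_ν` and `A_{ν+1}` have no common zeros. -/
theorem besselEntire_add_one_ne_zero {ν z : ℝ} (hν : 0 ≤ ν) (h : besselEntire ν z = 0) :
    besselEntire (ν + 1) z ≠ 0 := by
  intro h1
  have hz : z ≠ 0 := by
    rintro rfl
    rw [besselEntire_zero hν] at h
    have := Real.Gamma_pos_of_pos (show 0 < ν + 1 by positivity)
    exact (one_div_pos.2 this).ne' h
  -- The recurrence carries a common zero `z ≠ 0` up to every order, but at large order the leading
  -- term makes the value positive.
  have key : ∀ n : ℕ, besselEntire (ν + n) z = 0 ∧ besselEntire (ν + n + 1) z = 0 := by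
    intro n
    induction n with
    | zero => simpa using ⟨h, h1⟩
    | succ n ih =>
      have hr := besselEntire_recurrence (ν := ν + n) (by positivity) z
      rw [ih.1, ih.2] at hr
      have : besselEntire (ν + n + 1 + 1) z = 0 := by
        have h3 : z / 4 * besselEntire (ν + n + 1 + 1) z = 0 := by linarith
        rcases mul_eq_zero.1 h3 with h4 | h4
        · exact absurd h4 (by simpa using hz)
        · exact h4
      push_cast
      rw [← add_assoc]
      exact ⟨ih.2, this⟩
  obtain ⟨n, hn⟩ := (eventually_besselEntire_pos hν z).exists
  exact hn.ne' (key n).1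

/-- Legendre duplication turns `m! Γ(m + 3/2)` into a multiple of `(2m+1)!`, which gives the sine
series. -/
theorem besselEntire_half_sq {x : ℝ} (hx : x ≠ 0) :
    besselEntire (1 / 2) (x ^ 2) = 2 / √Real.pi * (Real.sin x / x) := by
  refine (hasSum_besselEntire (by norm_num) _).unique ?_
  convert! ((Real.hasSum_sin x).div_const x).mul_left (2 / √Real.pi) using 1
  funext m
  have h := Real.Gamma_mul_Gamma_add_half ((m : ℝ) + 1)
  rw [Real.Gamma_nat_eq_factorial] at h
  have h2 : Real.Gamma (2 * ((m : ℝ) + 1)) = ((2 * m + 1).factorial : ℝ) := by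
    rw [← Real.Gamma_nat_eq_factorial]; push_cast; ring_nf
  have h3 : (2 : ℝ) ^ (1 - 2 * ((m : ℝ) + 1)) = 1 / (2 * 4 ^ m) := by
    rw [show 1 - 2 * ((m : ℝ) + 1) = -((2 * m + 1 : ℕ) : ℝ) by push_cast; ring,
      Real.rpow_neg (by norm_num), Real.rpow_natCast, pow_succ, pow_mul]
    norm_num
    ring
  rw [show (m : ℝ) + 1 / 2 + 1 = (m : ℝ) + 1 + 1 / 2 by ring, h, h2, h3]
  have hpi : √Real.pi ≠ 0 := by positivity
  have hf : ((2 * m + 1).factorial : ℝ) ≠ 0 := by positivity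
  rw [div_pow, neg_pow, ← pow_mul]
  field_simp
  ring

/-- Induction by Rolle, since `A_{l+3/2}` is a multiple of the derivative of `A_{l+1/2}`. The base
case uses the zeros of the sine. -/
theorem exists_besselEntire_eq_zero (l : ℕ) (M : ℝ) :
    ∃ z, M < z ∧ besselEntire ((l : ℝ) + 1 / 2) z = 0 := by
  induction l generalizing M with
  | zero =>
    obtain ⟨n, hn⟩ := exists_nat_gt (max M 1)
    have hn1 : (1 : ℝ) < n := (le_max_right _ _).trans_lt hn
    have hpi := Real.pi_gt_three
    refine ⟨(n * Real.pi) ^ 2, ?_, ?_⟩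
    · have : M < n := (le_max_left _ _).trans_lt hn
      have h1 : (n : ℝ) < n * Real.pi := by nlinarith
      nlinarith
    · have := besselEntire_half_sq (x := n * Real.pi) (by positivity)
      simpa [Real.sin_nat_mul_pi] using this
  | succ l ih =>
    obtain ⟨a, ha, ha0⟩ := ih M
    obtain ⟨b, hb, hb0⟩ := ih a
    have hν : (0 : ℝ) ≤ (l : ℝ) + 1 / 2 := by positivity
    obtain ⟨c, hc, hc0⟩ := exists_hasDerivAt_eq_zero hb
      (continuous_besselEntire hν).continuousOn (ha0.trans hb0.symm)
      (fun x _ => hasDerivAt_besselEntire hν x)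
    refine ⟨c, ha.trans hc.1, ?_⟩
    rw [show (((l + 1 : ℕ) : ℝ) + 1 / 2) = (l : ℝ) + 1 / 2 + 1 by push_cast; ring]
    linarith

theorem besselJ_eq {ν x : ℝ} (hx : 0 < x) :
    besselJ ν x = (x / 2) ^ ν * besselEntire ν (x ^ 2) := by
  rw [besselJ, besselEntire, ← tsum_mul_left]
  congr 1
  funext m
  rw [Real.rpow_add (by positivity), show (2 * (m : ℝ)) = ((2 * m : ℕ) : ℝ) by push_cast; ring,
    Real.rpow_natCast, pow_mul, show -x ^ 2 / 4 = (-1) * (x / 2) ^ 2 by ring, mul_pow (-1 : ℝ)]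
  ring

theorem besselJ_eq_zero_iff {ν x : ℝ} (hx : 0 < x) :
    besselJ ν x = 0 ↔ besselEntire ν (x ^ 2) = 0 := by
  rw [besselJ_eq hx, mul_eq_zero, or_iff_right]
  positivity

/-- The infimum of the zeros of `J_{l+1/2}` beyond `a ≥ 0` is a zero beyond `a`. -/
theorem sInf_besselJ_zeros (l : ℕ) {a : ℝ} (ha : 0 ≤ a) :
    a < sInf {x : ℝ | a < x ∧ besselJ ((l : ℝ) + 1 / 2) x = 0} ∧
    besselEntire ((l : ℝ) + 1 / 2)
      (sInf {x : ℝ | a < x ∧ besselJ ((l : ℝ) + 1 / 2) x = 0} ^ 2) = 0 ∧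
    ∀ x, a < x → x < sInf {x : ℝ | a < x ∧ besselJ ((l : ℝ) + 1 / 2) x = 0} →
      besselEntire ((l : ℝ) + 1 / 2) (x ^ 2) ≠ 0 := by
  set ν : ℝ := (l : ℝ) + 1 / 2
  have hν : 0 ≤ ν := by positivity
  set S := {x : ℝ | a < x ∧ besselJ ν x = 0}
  have hS : S = {x : ℝ | a < x ∧ besselEntire ν (x ^ 2) = 0} := by
    ext x
    constructor
    · exact fun h => ⟨h.1, (besselJ_eq_zero_iff (ha.trans_lt h.1)).1 h.2⟩
    · exact fun h => ⟨h.1, (besselJ_eq_zero_iff (ha.trans_lt h.1)).2 h.2⟩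
  have hne : S.Nonempty := by
    obtain ⟨z, hz, hz0⟩ := exists_besselEntire_eq_zero l (a ^ 2)
    rw [hS]
    exact ⟨√z, Real.lt_sqrt_of_sq_lt hz, by rwa [Real.sq_sqrt ((sq_nonneg a).trans hz.le)]⟩
  have hbdd : BddBelow S := ⟨a, fun x hx => hx.1.le⟩
  have hcont : Continuous fun x : ℝ => besselEntire ν (x ^ 2) :=
    (continuous_besselEntire hν).comp (continuous_pow 2)
  have hle : a ≤ sInf S := le_csInf hne fun x hx => hx.1.le
  have hcl : sInf S ∈ closure S := csInf_mem_closure hne hbdd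
  have hzero : besselEntire ν (sInf S ^ 2) = 0 := by
    have hclosed : IsClosed {x : ℝ | besselEntire ν (x ^ 2) = 0} :=
      isClosed_eq hcont continuous_const
    exact (closure_minimal (fun x hx => (hS ▸ hx : x ∈ {x : ℝ | a < x ∧ _}).2) hclosed) hcl
  -- If the infimum were `a`, zeros would accumulate at `a`; but zeros of `A_ν` are simple, hence
  -- isolated.
  have hlt : a < sInf S := by
    refine lt_of_le_of_ne hle fun h => ?_
    rw [← h] at hzero hcl
    have hd := hasDerivAt_besselEntire hν (a ^ 2)
    have hev := hd.eventually_ne (c := 0)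
      (mul_ne_zero (by norm_num) (besselEntire_add_one_ne_zero hν hzero))
    rw [eventually_nhdsWithin_iff] at hev
    have hev2 := ((continuous_pow 2).tendsto a).eventually hev
    rw [mem_closure_iff_frequently] at hcl
    obtain ⟨x, hx, hx'⟩ := (hcl.and_eventually hev2).exists
    rw [hS] at hx
    exact hx' (by
      have := pow_lt_pow_left₀ hx.1 ha two_ne_zero
      simpa using this.ne') hx.2
  refine ⟨hlt, hzero, fun x hx hx' h0 => ?_⟩
  exact absurd (csInf_le hbdd (hS ▸ ⟨hx, h0⟩)) (not_le.2 hx')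

theorem besselZero_nonneg (l s : ℕ) : 0 ≤ besselZero ((l : ℝ) + 1 / 2) s := by
  induction s with
  | zero => exact le_rfl
  | succ s ih => exact ih.trans (sInf_besselJ_zeros l ih).1.le

theorem besselZero_lt_succ (l s : ℕ) :
    besselZero ((l : ℝ) + 1 / 2) s < besselZero ((l : ℝ) + 1 / 2) (s + 1) :=
  (sInf_besselJ_zeros l (besselZero_nonneg l s)).1

theorem besselEntire_besselZero_succ (l s : ℕ) :
    besselEntire ((l : ℝ) + 1 / 2) (besselZero ((l : ℝ) + 1 / 2) (s + 1) ^ 2) = 0 :=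
  (sInf_besselJ_zeros l (besselZero_nonneg l s)).2.1

theorem besselEntire_ne_zero_of_mem_Ioo (l s : ℕ) {x : ℝ}
    (hx : x ∈ Ioo (besselZero ((l : ℝ) + 1 / 2) s) (besselZero ((l : ℝ) + 1 / 2) (s + 1))) :
    besselEntire ((l : ℝ) + 1 / 2) (x ^ 2) ≠ 0 :=
  (sInf_besselJ_zeros l (besselZero_nonneg l s)).2.2 x hx.1 hx.2

/-! ### Modified Bessel functions of the second kind -/

theorem continuous_besselK_integrand (ν x : ℝ) :
    Continuous fun t : ℝ => Real.exp (-x * Real.cosh t) * Real.cosh (ν * t) := by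
  fun_prop

theorem cosh_le_exp_abs_mul {ν t : ℝ} (ht : 0 ≤ t) : Real.cosh (ν * t) ≤ Real.exp (|ν| * t) := by
  have h := neg_abs_le ν
  have h' := le_abs_self ν
  have h1 : Real.exp (ν * t) ≤ Real.exp (|ν| * t) := Real.exp_le_exp.2 (by gcongr)
  have h2 : Real.exp (-(ν * t)) ≤ Real.exp (|ν| * t) := Real.exp_le_exp.2 (by nlinarith)
  rw [Real.cosh_eq]
  linarith

/-- Since `cosh t ≥ t² / 4`, completing the square absorbs the linear term `(|ν| + 1) t` and leaves
`exp (-t)`. -/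
theorem besselK_integrand_le (ν : ℝ) {x t : ℝ} (hx : 0 < x) (ht : 0 ≤ t) :
    Real.exp (-x * Real.cosh t) * Real.cosh (ν * t)
      ≤ Real.exp ((|ν| + 1) ^ 2 / x) * Real.exp (-t) := by
  calc Real.exp (-x * Real.cosh t) * Real.cosh (ν * t)
      ≤ Real.exp (-x * Real.cosh t) * Real.exp (|ν| * t) := by
        gcongr; exact cosh_le_exp_abs_mul ht
    _ = Real.exp (-x * Real.cosh t + |ν| * t) := (Real.exp_add _ _).symm
    _ ≤ Real.exp ((|ν| + 1) ^ 2 / x + -t) := by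
        refine Real.exp_le_exp.2 ?_
        have h1 : t ^ 2 / 4 ≤ Real.cosh t := by
          have := Real.quadratic_le_exp_of_nonneg ht
          have := Real.exp_pos (-t)
          rw [Real.cosh_eq]
          linarith
        have h2 : (|ν| + 1) * t ≤ (|ν| + 1) ^ 2 / x + x * (t ^ 2 / 4) := by
          have h3 : (|ν| + 1) ^ 2 / x + x * (t ^ 2 / 4) - (|ν| + 1) * t
              = ((|ν| + 1) - x * t / 2) ^ 2 / x := by field_simp; ring
          have h4 : 0 ≤ ((|ν| + 1) - x * t / 2) ^ 2 / x := by positivity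
          linarith
        have h5 : x * (t ^ 2 / 4) ≤ x * Real.cosh t := by gcongr
        linarith
    _ = _ := Real.exp_add _ _

theorem integrableOn_besselK_integrand (ν : ℝ) {x : ℝ} (hx : 0 < x) :
    IntegrableOn (fun t : ℝ => Real.exp (-x * Real.cosh t) * Real.cosh (ν * t)) (Ioi 0) := by
  refine Integrable.mono' ((integrableOn_exp_neg_Ioi 0).const_mul (Real.exp ((|ν| + 1) ^ 2 / x)))
    (continuous_besselK_integrand ν x).aestronglyMeasurable ?_
  refine (ae_restrict_mem measurableSet_Ioi).mono fun t ht => ?_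
  rw [Real.norm_of_nonneg (by positivity)]
  exact besselK_integrand_le ν hx (le_of_lt ht)

theorem besselK_pos (ν : ℝ) {x : ℝ} (hx : 0 < x) : 0 < besselK ν x := by
  rw [besselK, setIntegral_pos_iff_support_of_nonneg_ae _ (integrableOn_besselK_integrand ν hx)]
  · have : Function.support (fun t : ℝ => Real.exp (-x * Real.cosh t) * Real.cosh (ν * t))
        = univ := by
      ext t
      have : 0 < Real.exp (-x * Real.cosh t) * Real.cosh (ν * t) := by positivity
      simpa using this.ne'
    rw [this]
    simp
  · exact Eventually.of_forall fun t => by positivity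

theorem cosh_mul_cosh_mul (ν t : ℝ) : Real.cosh t * Real.cosh (ν * t)
    = (Real.cosh ((ν + 1) * t) + Real.cosh ((ν - 1) * t)) / 2 := by
  rw [add_mul, sub_mul, one_mul, Real.cosh_add, Real.cosh_sub]
  ring

theorem sinh_mul_sinh_mul (ν t : ℝ) : Real.sinh t * Real.sinh (ν * t)
    = (Real.cosh ((ν + 1) * t) - Real.cosh ((ν - 1) * t)) / 2 := by
  rw [add_mul, sub_mul, one_mul, Real.cosh_add, Real.cosh_sub]
  ring

/-- Differentiation under the integral; for `y > x / 2` the derivative is dominated by its absolute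
value at `x / 2`. -/
theorem hasDerivAt_besselK_sub (ν : ℝ) {x : ℝ} (hx : 0 < x) :
    HasDerivAt (besselK ν) (-(besselK (ν + 1) x + besselK (ν - 1) x) / 2) x := by
  have hint : ∀ y : ℝ, 0 < y → IntegrableOn (fun t : ℝ =>
      Real.cosh t * (Real.exp (-y * Real.cosh t) * Real.cosh (ν * t))) (Ioi 0) := by
    intro y hy
    have := ((integrableOn_besselK_integrand (ν + 1) hy).add
      (integrableOn_besselK_integrand (ν - 1) hy)).div_const 2
    refine this.congr (Eventually.of_forall fun t => ?_)
    have := cosh_mul_cosh_mul ν t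
    simp only [Pi.add_apply]
    linear_combination (-Real.exp (-y * Real.cosh t)) * this
  have h := (hasDerivAt_integral_of_dominated_loc_of_deriv_le
    (μ := volume.restrict (Ioi (0 : ℝ))) (x₀ := x) (s := Ioi (x / 2))
    (F := fun y t : ℝ => Real.exp (-y * Real.cosh t) * Real.cosh (ν * t))
    (F' := fun y t : ℝ => -(Real.cosh t * (Real.exp (-y * Real.cosh t) * Real.cosh (ν * t))))
    (bound := fun t => Real.cosh t * (Real.exp (-(x / 2) * Real.cosh t) * Real.cosh (ν * t)))
    (Ioi_mem_nhds (by linarith))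
    (Eventually.of_forall fun y => (continuous_besselK_integrand ν y).aestronglyMeasurable)
    (integrableOn_besselK_integrand ν hx) (hint x hx).neg.aestronglyMeasurable
    (Eventually.of_forall fun t y hy => ?_) (hint _ (by positivity))
    (Eventually.of_forall fun t y _ => ?_)).2
  · refine h.congr_deriv ?_
    rw [integral_neg, besselK, besselK, ← integral_add (integrableOn_besselK_integrand _ hx)
      (integrableOn_besselK_integrand _ hx), neg_div, ← integral_div]
    congr 1
    refine integral_congr_ae (Eventually.of_forall fun t => ?_)
    have := cosh_mul_cosh_mul ν t
    simp only
    linear_combination (Real.exp (-x * Real.cosh t)) * this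
  · rw [norm_neg, Real.norm_of_nonneg (by positivity)]
    have hy' : x / 2 ≤ y := le_of_lt hy
    gcongr
  · have h1 : HasDerivAt (fun y : ℝ => -y * Real.cosh t) (-1 * Real.cosh t) y :=
      (hasDerivAt_id y).neg.mul_const _
    exact (h1.exp.mul_const _).congr_deriv (by ring)

/-- Integrate the derivative of `exp (-x cosh t) sinh (ν t)` over `(0, ∞)`; both boundary terms
vanish. -/
theorem besselK_recurrence (ν : ℝ) {x : ℝ} (hx : 0 < x) :
    besselK (ν + 1) x = besselK (ν - 1) x + 2 * ν / x * besselK ν x := by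
  have hi := integrableOn_besselK_integrand
  have hd : ∀ t ∈ Ici (0 : ℝ), HasDerivAt
      (fun t => -(2 / x) * (Real.exp (-x * Real.cosh t) * Real.sinh (ν * t)))
      (Real.exp (-x * Real.cosh t) * Real.cosh ((ν + 1) * t)
        - Real.exp (-x * Real.cosh t) * Real.cosh ((ν - 1) * t)
        - 2 * ν / x * (Real.exp (-x * Real.cosh t) * Real.cosh (ν * t))) t := by
    intro t _
    have h1 : HasDerivAt (fun t : ℝ => Real.exp (-x * Real.cosh t))
        (Real.exp (-x * Real.cosh t) * (-x * Real.sinh t)) t :=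
      ((Real.hasDerivAt_cosh t).const_mul (-x)).exp
    have h2 : HasDerivAt (fun t : ℝ => Real.sinh (ν * t)) (Real.cosh (ν * t) * (ν * 1)) t :=
      ((hasDerivAt_id t).const_mul ν).sinh
    refine ((h1.mul h2).const_mul (-(2 / x))).congr_deriv ?_
    have h3 := sinh_mul_sinh_mul ν t
    have h4 : 2 / x * x = 2 := by field_simp
    linear_combination (2 * Real.exp (-x * Real.cosh t)) * h3
      + (Real.exp (-x * Real.cosh t) * Real.sinh t * Real.sinh (ν * t)) * h4
  have hint : IntegrableOn (fun t => Real.exp (-x * Real.cosh t) * Real.cosh ((ν + 1) * t)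
        - Real.exp (-x * Real.cosh t) * Real.cosh ((ν - 1) * t)
        - 2 * ν / x * (Real.exp (-x * Real.cosh t) * Real.cosh (ν * t))) (Ioi 0) :=
    ((hi _ hx).sub (hi _ hx)).sub ((hi _ hx).const_mul _)
  have hlim : Tendsto (fun t => -(2 / x) * (Real.exp (-x * Real.cosh t) * Real.sinh (ν * t)))
      atTop (𝓝 0) := by
    have hb : Tendsto (fun t : ℝ => Real.exp ((|ν| + 1) ^ 2 / x) * Real.exp (-t)) atTop (𝓝 0) := by
      simpa using (Real.tendsto_exp_neg_atTop_nhds_zero.const_mul (Real.exp ((|ν| + 1) ^ 2 / x)))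
    have := squeeze_zero_norm' (f := fun t => Real.exp (-x * Real.cosh t) * Real.sinh (ν * t))
      ((eventually_ge_atTop (0 : ℝ)).mono fun t ht => ?_) hb
    · simpa using this.const_mul (-(2 / x))
    · refine le_trans ?_ (besselK_integrand_le ν hx ht)
      rw [norm_mul, Real.norm_of_nonneg (by positivity), Real.norm_eq_abs, Real.abs_sinh,
        ← Real.cosh_abs (ν * t)]
      gcongr
      exact (Real.sinh_lt_cosh _).le
  have h := integral_Ioi_of_hasDerivAt_of_tendsto' hd hint hlim
  have h1 := integral_sub ((hi (ν + 1) hx).sub (hi (ν - 1) hx)) ((hi ν hx).const_mul (2 * ν / x))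
  simp only [Pi.sub_apply] at h1
  rw [h1, integral_sub (hi _ hx) (hi _ hx), integral_const_mul] at h
  simp only [mul_zero, Real.sinh_zero, sub_zero] at h
  simp only [besselK]
  linarith

theorem hasDerivAt_besselK (ν : ℝ) {x : ℝ} (hx : 0 < x) :
    HasDerivAt (besselK ν) (ν / x * besselK ν x - besselK (ν + 1) x) x := by
  refine (hasDerivAt_besselK_sub ν hx).congr_deriv ?_
  rw [besselK_recurrence ν hx]
  ring

theorem hasDerivAt_besselK_add_one (ν : ℝ) {x : ℝ} (hx : 0 < x) :
    HasDerivAt (besselK (ν + 1)) (-besselK ν x - (ν + 1) / x * besselK (ν + 1) x) x := by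
  refine (hasDerivAt_besselK_sub (ν + 1) hx).congr_deriv ?_
  rw [besselK_recurrence (ν + 1) hx, add_sub_cancel_right]
  ring

theorem besselK_le_of_abs_le {μ ν x : ℝ} (hx : 0 < x) (h : |μ| ≤ |ν|) :
    besselK μ x ≤ besselK ν x := by
  refine setIntegral_mono_on (integrableOn_besselK_integrand _ hx)
    (integrableOn_besselK_integrand _ hx) measurableSet_Ioi fun t _ => ?_
  gcongr
  rw [Real.cosh_le_cosh, abs_mul, abs_mul]
  gcongr

theorem besselK_le_exp_mul {ν x y : ℝ} (hx : 0 < x) (hxy : x ≤ y) :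
    besselK ν y ≤ Real.exp (-(y - x)) * besselK ν x := by
  rw [besselK, besselK, ← integral_const_mul]
  refine setIntegral_mono_on (integrableOn_besselK_integrand _ (hx.trans_le hxy))
    ((integrableOn_besselK_integrand _ hx).const_mul _) measurableSet_Ioi fun t _ => ?_
  rw [← mul_assoc, ← Real.exp_add]
  gcongr
  nlinarith [Real.one_le_cosh t]

/-- For `σ > 0` this is `σ K_{ν+1}(σ) / K_ν(σ)`; at `σ = 0` it is the limit `2 ν`. -/
noncomputable def besselKRatio (ν σ : ℝ) : ℝ := 2 * ν + σ * (besselK (ν - 1) σ / besselK ν σ)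

theorem besselKRatio_zero (ν : ℝ) : besselKRatio ν 0 = 2 * ν := by simp [besselKRatio]

theorem besselKRatio_eq (ν : ℝ) {σ : ℝ} (hσ : 0 < σ) :
    besselKRatio ν σ = σ * besselK (ν + 1) σ / besselK ν σ := by
  have := besselK_pos ν hσ
  rw [besselKRatio, besselK_recurrence ν hσ]
  field_simp
  ring

theorem le_besselKRatio {ν σ : ℝ} (hν : 0 ≤ ν) (hσ : 0 < σ) : σ ≤ besselKRatio ν σ := by
  rw [besselKRatio_eq ν hσ, le_div_iff₀ (besselK_pos ν hσ)]
  gcongr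
  refine besselK_le_of_abs_le hσ ?_
  rw [abs_of_nonneg hν, abs_of_nonneg (by positivity)]
  linarith

/-- Only `σ = 0` is delicate. The condition `1/2 ≤ ν` means `|ν - 1| ≤ ν`, so `K_{ν-1} ≤ K_ν` and
the correction to `2 ν` is at most `σ`. -/
theorem continuousOn_besselKRatio {ν : ℝ} (hν : 1 / 2 ≤ ν) :
    ContinuousOn (besselKRatio ν) (Ici 0) := by
  intro σ hσ
  rcases (mem_Ici.1 hσ).eq_or_lt with rfl | hσ
  · refine ContinuousWithinAt.add continuousWithinAt_const ?_
    refine squeeze_zero_norm' (a := fun σ : ℝ => σ) ?_ ?_ |>.mono_right (by simp)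
    · refine eventually_mem_nhdsWithin.mono fun σ hσ => ?_
      rcases (mem_Ici.1 hσ).eq_or_lt with rfl | hσ
      · simp
      · have h1 := besselK_pos (ν - 1) hσ
        have h2 := besselK_pos ν hσ
        rw [Real.norm_of_nonneg (by positivity)]
        refine mul_le_of_le_one_right hσ.le ((div_le_one h2).2 (besselK_le_of_abs_le hσ ?_))
        rw [abs_of_nonneg (by linarith : 0 ≤ ν), abs_le]
        constructor <;> linarith
    · exact tendsto_id.mono_left nhdsWithin_le_nhds
  · have h1 := (hasDerivAt_besselK (ν - 1) hσ).continuousAt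
    have h2 := (hasDerivAt_besselK ν hσ).continuousAt
    exact (continuousAt_const.add (continuousAt_id.mul
      (h1.div h2 (besselK_pos ν hσ).ne'))).continuousWithinAt

/-! ### Picone comparison -/

theorem Convex.monotoneOn_of_hasDerivAt_nonneg {s : Set ℝ} (hs : Convex ℝ s) {f f' : ℝ → ℝ}
    (hf : ∀ x ∈ s, HasDerivAt f (f' x) x) (hf' : ∀ x ∈ s, 0 ≤ f' x) : MonotoneOn f s :=
  monotoneOn_of_hasDerivWithinAt_nonneg hs (fun x hx => (hf x hx).continuousAt.continuousWithinAt)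
    (fun x hx => (hf x (interior_subset hx)).hasDerivWithinAt)
    (fun x hx => hf' x (interior_subset hx))

/-- A solution of `u'' = q u` with `q` bounded below that vanishes at `0⁺` satisfies
`u ^ 2 = O(r)`. -/
theorem exists_sq_le_mul_of_tendsto_zero {R M : ℝ} {u u' q : ℝ → ℝ} (hR : 0 < R)
    (hu : ∀ r ∈ Ioo 0 R, HasDerivAt u (u' r) r)
    (hu' : ∀ r ∈ Ioo 0 R, HasDerivAt u' (q r * u r) r)
    (hq : ∀ r ∈ Ioo 0 R, -M ≤ q r) (h0 : Tendsto u (𝓝[>] 0) (𝓝 0)) :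
    ∃ D ρ : ℝ, 0 < D ∧ 0 < ρ ∧ ρ < R ∧ ∀ r ∈ Ioo 0 ρ, u r ^ 2 ≤ D * r := by
  have hsmall : ∀ᶠ r in 𝓝[>] (0 : ℝ), u r ^ 2 < 1 := by
    have : Tendsto (fun r => u r ^ 2) (𝓝[>] 0) (𝓝 0) := by simpa using h0.pow 2
    exact this.eventually (gt_mem_nhds one_pos)
  obtain ⟨ε, hε, hεu⟩ := mem_nhdsGT_iff_exists_Ioo_subset.1 hsmall
  set δ := min ε R
  have hδ : 0 < δ := lt_min hε hR
  have hsub : ∀ r ∈ Ioo 0 δ, r ∈ Ioo 0 R := fun r hr => ⟨hr.1, hr.2.trans_le (min_le_right _ _)⟩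
  -- Where `u² < 1`, the function `u² + |M| r²` is convex. It tends to `0` at `0`, so on `(0, ρ)` it
  -- lies below `d r`, with `d` its slope at `ρ`.
  have hder : MonotoneOn (fun r => 2 * (u r * u' r) + 2 * |M| * r) (Ioo 0 δ) := by
    refine (convex_Ioo 0 δ).monotoneOn_of_hasDerivAt_nonneg
      (f' := fun r => 2 * (u' r * u' r + u r * (q r * u r)) + 2 * |M| * 1)
      (fun r hr => (((hu r (hsub r hr)).mul (hu' r (hsub r hr))).const_mul 2).add
        ((hasDerivAt_id r).const_mul _)) fun r hr => ?_
    have h1 : u r ^ 2 < 1 := hεu ⟨hr.1, hr.2.trans_le (min_le_left _ _)⟩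
    have h2 : -|M| ≤ q r := (neg_le_neg (le_abs_self M)).trans (hq r (hsub r hr))
    have h3 : -|M| ≤ q r * u r ^ 2 := by
      nlinarith [mul_le_mul_of_nonneg_right h2 (sq_nonneg (u r)), abs_nonneg M]
    nlinarith [mul_self_nonneg (u' r)]
  set ρ := δ / 2
  have hρ : ρ ∈ Ioo 0 δ := ⟨by positivity, by simp only [ρ]; linarith⟩
  set d := 2 * (u ρ * u' ρ) + 2 * |M| * ρ
  have hsub2 : ∀ r ∈ Ioo 0 ρ, r ∈ Ioo 0 δ := fun r hr => ⟨hr.1, hr.2.trans hρ.2⟩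
  have hmono : MonotoneOn (fun r => d * r - (u r ^ 2 + |M| * r ^ 2)) (Ioo 0 ρ) := by
    refine (convex_Ioo 0 ρ).monotoneOn_of_hasDerivAt_nonneg
      (f' := fun r => d * 1 - (2 * u r ^ (2 - 1) * u' r + |M| * (2 * r ^ (2 - 1) * 1)))
      (fun r hr => ((hasDerivAt_id r).const_mul d).sub
        (((hu r (hsub r (hsub2 r hr))).pow 2).add
          (((hasDerivAt_id r).pow 2).const_mul _))) fun r hr => ?_
    have := hder (hsub2 r hr) hρ hr.2.le
    simp only at this
    norm_num
    nlinarith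
  refine ⟨|d| + 1, ρ, by positivity, hρ.1, (hsub ρ hρ).2, fun r hr => ?_⟩
  have hlim : Tendsto (fun r => d * r - (u r ^ 2 + |M| * r ^ 2)) (𝓝[>] 0) (𝓝 0) := by
    have hid : Tendsto (fun r : ℝ => r) (𝓝[>] 0) (𝓝 0) := tendsto_id.mono_left nhdsWithin_le_nhds
    simpa using (hid.const_mul d).sub ((h0.pow 2).add ((hid.pow 2).const_mul |M|))
  have h1 : 0 ≤ d * r - (u r ^ 2 + |M| * r ^ 2) := by
    refine le_of_tendsto hlim ?_
    filter_upwards [Ioo_mem_nhdsGT hr.1] with s hs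
    exact hmono ⟨hs.1, hs.2.trans hr.2⟩ hr hs.2.le
  have h2 : 0 ≤ |M| * r ^ 2 := by positivity
  have h3 : d * r ≤ |d| * r := mul_le_mul_of_nonneg_right (le_abs_self d) hr.1.le
  nlinarith [hr.1]

theorem picone_hasDerivAt {u u' g q : ℝ → ℝ} {c r : ℝ} (hu : HasDerivAt u (u' r) r)
    (hu' : HasDerivAt u' (q r * u r) r) (hg : HasDerivAt g (q r - c - g r ^ 2) r) :
    HasDerivAt (fun r => u r * u' r - u r ^ 2 * g r) ((u' r - u r * g r) ^ 2 + c * u r ^ 2) r := by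
  refine ((hu.mul hu').sub ((hu.pow 2).mul hg)).congr_deriv ?_
  simp only [Pi.pow_apply]
  norm_num
  ring

/-- Picone comparison on `(0, R)` of a solution `u` of `u'' = q u` vanishing at `0⁺` with a
logarithmic derivative `g` for the potential `q - c`, where `c > 0`. -/
theorem picone_nonneg_of_tendsto_zero {R M c L : ℝ} {u u' g q : ℝ → ℝ} (hR : 0 < R) (hc : 0 < c)
    (hu : ∀ r ∈ Ioo 0 R, HasDerivAt u (u' r) r)
    (hu' : ∀ r ∈ Ioo 0 R, HasDerivAt u' (q r * u r) r)
    (hq : ∀ r ∈ Ioo 0 R, -M ≤ q r)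
    (hg : ∀ r ∈ Ioo 0 R, HasDerivAt g (q r - c - g r ^ 2) r)
    (h0 : Tendsto u (𝓝[>] 0) (𝓝 0))
    (hL : Tendsto (fun r => u r * u' r - u r ^ 2 * g r) (𝓝[<] R) (𝓝 L)) :
    0 ≤ L ∧ (L = 0 → ∀ r ∈ Ioo 0 R, u r = 0) := by
  set F : ℝ → ℝ := fun r => u r * u' r - u r ^ 2 * g r
  have hF : ∀ r ∈ Ioo 0 R, HasDerivAt F ((u' r - u r * g r) ^ 2 + c * u r ^ 2) r :=
    fun r hr => picone_hasDerivAt (hu r hr) (hu' r hr) (hg r hr)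
  have hmono : MonotoneOn F (Ioo 0 R) :=
    (convex_Ioo 0 R).monotoneOn_of_hasDerivAt_nonneg hF fun r _ => by positivity
  -- A negative value persists towards `0`. There `F² = u² (u' - u g)² ≤ D r F'`, so `(-1/F)' ≥ 1 /
  -- (D r)`. Integrating down to `0` makes the logarithm diverge, although `-1/F` stays positive. No
  -- behaviour of `u'` or `g` at `0` is needed.
  have hnonneg : ∀ r ∈ Ioo 0 R, 0 ≤ F r := by
    intro r₀ hr₀
    by_contra! hneg
    obtain ⟨D, ρ, hD, hρ, hρR, hDu⟩ := exists_sq_le_mul_of_tendsto_zero hR hu hu' hq h0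
    set δ := min ρ r₀
    have hδ : 0 < δ := lt_min hρ hr₀.1
    have hsub : ∀ r ∈ Ioo 0 δ, r ∈ Ioo 0 R := fun r hr =>
      ⟨hr.1, (hr.2.trans_le (min_le_right _ _)).trans hr₀.2⟩
    have hFneg : ∀ r ∈ Ioo 0 δ, F r < 0 := fun r hr =>
      (hmono (hsub r hr) hr₀ (hr.2.trans_le (min_le_right _ _)).le).trans_lt hneg
    have hP : MonotoneOn (fun r => -(F r)⁻¹ - D⁻¹ * Real.log r) (Ioo 0 δ) := by
      refine (convex_Ioo 0 δ).monotoneOn_of_hasDerivAt_nonneg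
        (f' := fun r => -(-((u' r - u r * g r) ^ 2 + c * u r ^ 2) / F r ^ 2) - D⁻¹ * r⁻¹)
        (fun r hr => (((hF r (hsub r hr)).inv (hFneg r hr).ne).neg).sub
          ((Real.hasDerivAt_log hr.1.ne').const_mul D⁻¹)) fun r hr => ?_
      have hFr := hFneg r hr
      have hFsq : 0 < F r ^ 2 := sq_pos_of_neg hFr
      have h1 : u r ^ 2 ≤ D * r := hDu r ⟨hr.1, hr.2.trans_le (min_le_left _ _)⟩
      have h2 : F r ^ 2 = u r ^ 2 * (u' r - u r * g r) ^ 2 := by simp only [F]; ring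
      have h3 : F r ^ 2 ≤ D * r * ((u' r - u r * g r) ^ 2 + c * u r ^ 2) := by
        rw [h2]
        have h4 : 0 ≤ c * u r ^ 2 := by positivity
        have := hr.1
        gcongr
        linarith
      have h5 : 0 < D * r := mul_pos hD hr.1
      rw [neg_div, neg_neg, sub_nonneg, ← mul_inv, inv_eq_one_div, div_le_div_iff₀ h5 hFsq]
      linarith
    have hδ2 : δ / 2 ∈ Ioo 0 δ := ⟨by positivity, by linarith⟩
    have hlog : ∀ᶠ s in 𝓝[>] (0 : ℝ),
        Real.log s < -D * (-(F (δ / 2))⁻¹ - D⁻¹ * Real.log (δ / 2)) :=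
      Real.tendsto_log_nhdsGT_zero.eventually (eventually_lt_atBot _)
    obtain ⟨s, hs, hsδ⟩ := (hlog.and (Ioo_mem_nhdsGT hδ2.1)).exists
    have hsI : s ∈ Ioo 0 δ := ⟨hsδ.1, hsδ.2.trans hδ2.2⟩
    have h1 := hP hsI hδ2 hsδ.2.le
    have h2 : 0 < -(F s)⁻¹ := neg_pos.2 (inv_lt_zero.2 (hFneg s hsI))
    simp only at h1
    have h3 : -(D⁻¹ * Real.log s) < -(F (δ / 2))⁻¹ - D⁻¹ * Real.log (δ / 2) := by linarith
    have h4 := mul_lt_mul_of_pos_left h3 hD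
    have h5 : D * -(D⁻¹ * Real.log s) = -Real.log s := by field_simp
    linarith
  have hle : ∀ r ∈ Ioo 0 R, F r ≤ L := fun r hr => by
    refine ge_of_tendsto hL ?_
    filter_upwards [Ioo_mem_nhdsLT hr.2] with s hs
    exact hmono hr ⟨hr.1.trans hs.1, hs.2⟩ hs.1.le
  have hR2 : R / 2 ∈ Ioo 0 R := ⟨by positivity, by linarith⟩
  refine ⟨(hnonneg _ hR2).trans (hle _ hR2), fun hL0 r hr => ?_⟩
  -- Squeezed between `0` and `L = 0`, `F` is constant, so its derivative, which is at least `c u²`,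
  -- vanishes.
  have hzero : F =ᶠ[𝓝 r] fun _ => 0 := by
    filter_upwards [Ioo_mem_nhds hr.1 hr.2] with s hs
    exact le_antisymm ((hle s hs).trans hL0.le) (hnonneg s hs)
  have h1 := (hF r hr).unique ((hasDerivAt_const r (0 : ℝ)).congr_of_eventuallyEq hzero)
  have h2 : c * u r ^ 2 ≤ 0 := by nlinarith [sq_nonneg (u' r - u r * g r)]
  have h3 : u r ^ 2 ≤ 0 := by nlinarith [sq_nonneg (u r)]
  exact pow_eq_zero_iff two_ne_zero |>.1 (le_antisymm h3 (sq_nonneg _))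

/-- Picone comparison on `(R, ∞)` of a square integrable solution with `r ^ (-l)`. -/
theorem picone_nonpos_of_integrable_sq {R c L : ℝ} {u u' : ℝ → ℝ} (l : ℕ) (hR : 0 < R) (hc : 0 < c)
    (hu : ∀ r ∈ Ioi R, HasDerivAt u (u' r) r)
    (hu' : ∀ r ∈ Ioi R, HasDerivAt u' (((l : ℝ) * (l + 1) / r ^ 2 + c) * u r) r)
    (hint : IntegrableOn (fun r => u r ^ 2) (Ioi R))
    (hL : Tendsto (fun r => u r * u' r - u r ^ 2 * (-l / r)) (𝓝[>] R) (𝓝 L)) :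
    L ≤ 0 ∧ (L = 0 → ∀ r ∈ Ioi R, u r = 0) := by
  set G : ℝ → ℝ := fun r => u r * u' r - u r ^ 2 * (-l / r)
  have hpos : ∀ r ∈ Ioi R, 0 < r := fun r hr => hR.trans hr
  have hG : ∀ r ∈ Ioi R, HasDerivAt G ((u' r - u r * (-l / r)) ^ 2 + c * u r ^ 2) r := by
    intro r hr
    have hr0 := hpos r hr
    refine picone_hasDerivAt (q := fun r => (l : ℝ) * (l + 1) / r ^ 2 + c) (g := fun r => -l / r)
      (hu r hr) (hu' r hr) ?_
    refine ((hasDerivAt_const r (-(l : ℝ))).div (hasDerivAt_id r) hr0.ne').congr_deriv ?_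
    simp only [id]
    field_simp
    ring
  have hmono : MonotoneOn G (Ioi R) :=
    (convex_Ioi R).monotoneOn_of_hasDerivAt_nonneg hG fun r _ => by positivity
  have hnonpos : ∀ r ∈ Ioi R, G r ≤ 0 := by
    intro r₀ hr₀
    by_contra! hd
    set d := G r₀
    have hr₀0 := hpos r₀ hr₀
    -- Since `(r^(2l) u²)' = 2 r^(2l) G ≥ 2 d r^(2l)`, this `a` makes `r^(2l) u² - a r^(2l+1)`
    -- increasing. Hence `u² ≥ a` beyond `r₀ + 1`, against integrability.
    set a : ℝ := 2 * d / (2 * l + 1)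
    have ha : 0 < a := by positivity
    have hsub : ∀ r ∈ Ici r₀, r ∈ Ioi R := fun r hr =>
      lt_of_lt_of_le (mem_Ioi.1 hr₀) (mem_Ici.1 hr)
    have hN : MonotoneOn (fun r => r ^ (2 * l) * u r ^ 2 - a * r ^ (2 * l + 1)) (Ici r₀) := by
      refine (convex_Ici r₀).monotoneOn_of_hasDerivAt_nonneg
        (f' := fun r => 2 * r ^ (2 * l) * (G r - d)) (fun r hr => ?_) fun r hr => ?_
      · have hr0 := hpos r (hsub r hr)
        have h1 : HasDerivAt (fun r : ℝ => r ^ (2 * l)) (2 * l / r * r ^ (2 * l)) r := by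
          refine (hasDerivAt_pow (2 * l) r).congr_deriv ?_
          rcases Nat.eq_zero_or_pos l with rfl | hl
          · simp
          · obtain ⟨k, hk⟩ : ∃ k, 2 * l = k + 1 := ⟨2 * l - 1, by omega⟩
            have hk' : (2 : ℝ) * l = k + 1 := by exact_mod_cast hk
            rw [hk, hk', pow_succ]
            push_cast
            field_simp
        refine ((h1.mul ((hu r (hsub r hr)).pow 2)).sub
          ((hasDerivAt_pow (2 * l + 1) r).const_mul a)).congr_deriv ?_
        simp only [G, a, Pi.pow_apply, Nat.add_sub_cancel]
        push_cast
        field_simp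
        ring
      · have hr0 := hpos r (hsub r hr)
        have : d ≤ G r := hmono hr₀ (hsub r hr) hr
        have : 0 ≤ G r - d := by linarith
        positivity
    have hlow : ∀ r ∈ Ici (r₀ + 1), a ≤ u r ^ 2 := by
      intro r hr
      have hr1 : r₀ + 1 ≤ r := hr
      have hr0 : 0 < r := by linarith
      have h1 := hN (mem_Ici.2 le_rfl) (mem_Ici.2 (by linarith)) (by linarith : r₀ ≤ r)
      simp only at h1
      have h2 : r₀ ^ (2 * l) ≤ r ^ (2 * l) := by gcongr; linarith
      have h3 : 0 < r ^ (2 * l) := by positivity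
      have h4 : 0 ≤ r₀ ^ (2 * l) * u r₀ ^ 2 := by positivity
      have h5 : a * r₀ ^ (2 * l + 1) ≤ a * (r ^ (2 * l) * r₀) := by
        rw [pow_succ]; gcongr
      have h6 : r ^ (2 * l) * (a * (r - r₀)) ≤ r ^ (2 * l) * u r ^ 2 := by
        rw [pow_succ r] at h1
        linarith
      have h7 := le_of_mul_le_mul_left h6 h3
      nlinarith
    have hconst : IntegrableOn (fun _ : ℝ => a) (Ici (r₀ + 1)) := by
      refine Integrable.mono' (hint.mono_set fun r hr => ?_) aestronglyMeasurable_const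
        ((ae_restrict_mem measurableSet_Ici).mono fun r hr => ?_)
      · exact lt_of_lt_of_le (lt_trans (mem_Ioi.1 hr₀) (lt_add_one r₀)) hr
      · rw [Real.norm_of_nonneg ha.le]
        exact hlow r hr
    rw [integrableOn_const_iff (by simp)] at hconst
    simp [ha.ne'] at hconst
  have hle : ∀ r ∈ Ioi R, L ≤ G r := fun r hr => by
    refine le_of_tendsto hL ?_
    filter_upwards [Ioo_mem_nhdsGT (mem_Ioi.1 hr)] with s hs
    exact hmono hs.1 hr hs.2.le
  have hR1 : R + 1 ∈ Ioi R := lt_add_one R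
  refine ⟨(hle _ hR1).trans (hnonpos _ hR1), fun hL0 r hr => ?_⟩
  have hzero : G =ᶠ[𝓝 r] fun _ => 0 := by
    filter_upwards [Ioi_mem_nhds hr] with s hs
    exact le_antisymm (hnonpos s hs) (hL0.ge.trans (hle s hs))
  have h1 := (hG r hr).unique ((hasDerivAt_const r (0 : ℝ)).congr_of_eventuallyEq hzero)
  have h2 : c * u r ^ 2 ≤ 0 := by nlinarith [sq_nonneg (u' r - u r * (-l / r))]
  have h3 : u r ^ 2 ≤ 0 := by nlinarith [sq_nonneg (u r)]
  exact pow_eq_zero_iff two_ne_zero |>.1 (le_antisymm h3 (sq_nonneg _))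

/-! ### The Riccati equation of the regular solution -/

/-- The logarithmic derivative of `r ^ (l + 1) * A_{l+1/2}(k r ^ 2)`. -/
noncomputable def innerLogDeriv (l : ℕ) (k r : ℝ) : ℝ :=
  (l + 1) / r - k * r / 2 *
    (besselEntire ((l : ℝ) + 1 / 2 + 1) (k * r ^ 2) / besselEntire ((l : ℝ) + 1 / 2) (k * r ^ 2))

theorem hasDerivAt_besselEntire_mul_sq {ν : ℝ} (hν : 0 ≤ ν) (k r : ℝ) :
    HasDerivAt (fun r => besselEntire ν (k * r ^ 2))
      (-(k * r / 2) * besselEntire (ν + 1) (k * r ^ 2)) r := by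
  refine ((hasDerivAt_besselEntire hν (k * r ^ 2)).comp r
    ((hasDerivAt_pow 2 r).const_mul k)).congr_deriv ?_
  norm_num
  ring

theorem hasDerivAt_innerLogDeriv (l : ℕ) (k : ℝ) {r : ℝ} (hr : r ≠ 0)
    (hA : besselEntire ((l : ℝ) + 1 / 2) (k * r ^ 2) ≠ 0) :
    HasDerivAt (innerLogDeriv l k)
      ((l : ℝ) * (l + 1) / r ^ 2 - k - innerLogDeriv l k r ^ 2) r := by
  have hν : (0 : ℝ) ≤ (l : ℝ) + 1 / 2 := by positivity
  have h1 := hasDerivAt_besselEntire_mul_sq hν k r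
  have h2 := hasDerivAt_besselEntire_mul_sq (ν := (l : ℝ) + 1 / 2 + 1) (by positivity) k r
  have h3 := besselEntire_recurrence hν (k * r ^ 2)
  refine (((hasDerivAt_const r ((l : ℝ) + 1)).div (hasDerivAt_id r) hr).sub
    ((((hasDerivAt_id r).const_mul k).div_const 2).mul (h2.div h1 hA))).congr_deriv ?_
  simp only [innerLogDeriv, id, Pi.div_apply]
  set a := besselEntire ((l : ℝ) + 1 / 2) (k * r ^ 2)
  set b := besselEntire ((l : ℝ) + 1 / 2 + 1) (k * r ^ 2)
  set e := besselEntire ((l : ℝ) + 1 / 2 + 1 + 1) (k * r ^ 2)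
  have h4 : k * r ^ 2 * e = 4 * (((l : ℝ) + 3 / 2) * b - a) := by linear_combination 4 * h3
  field_simp
  linear_combination (k * a * r ^ 2) * h4

/-! ### Absence of bound states and existence of the maximum -/

namespace DeltaWell

variable (p : DeltaWell)

theorem v0_pos : 0 < p.v0 := by
  have := p.hbar_pos
  have := p.mu_pos
  have := p.R_pos
  have := p.V0_pos
  exact Real.sqrt_pos.2 (by positivity)

theorem v0_sq : p.v0 ^ 2 = 2 * p.mu * p.R ^ 2 * p.V0 / p.hbar ^ 2 := by
  have := p.mu_pos
  have := p.V0_pos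
  exact Real.sq_sqrt (by positivity)

theorem v0_sq_div_R_sq : p.v0 ^ 2 / p.R ^ 2 = 2 * p.mu / p.hbar ^ 2 * p.V0 := by
  have := p.R_pos
  rw [v0_sq]
  field_simp

theorem phi_eq (l : ℕ) {χ : ℝ} (hχ : 0 < χ) :
    phi l χ = χ ^ 2 / 2 * (besselEntire ((l : ℝ) + 1 / 2 + 1) (χ ^ 2) /
      besselEntire ((l : ℝ) + 1 / 2) (χ ^ 2)) := by
  have h : (0 : ℝ) < (χ / 2) ^ ((l : ℝ) + 1 / 2) := by positivity
  rw [phi, besselJ_eq hχ, besselJ_eq hχ, show (l : ℝ) + 3 / 2 = (l : ℝ) + 1 / 2 + 1 by ring,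
    Real.rpow_add_one (by positivity), mul_div_assoc, mul_assoc, mul_div_mul_left _ _ h.ne']
  ring

/-- `φ̂_l` with `σ K_{l+3/2}(σ) / K_{l+1/2}(σ)` continued to `σ = 0`. -/
noncomputable def phiHatExt (l : ℕ) (σ : ℝ) : ℝ :=
  (2 + p.beta) ^ 2 / (2 - p.beta) ^ 2 * besselKRatio ((l : ℝ) + 1 / 2) σ
    - 8 * p.beta * ((l : ℝ) + 1) / (2 - p.beta) ^ 2
    + p.w l / (2 - p.beta) ^ 2

theorem phiHat_eq_phiHatExt (l : ℕ) {σ : ℝ} (hσ : 0 < σ) : p.phiHat l σ = p.phiHatExt l σ := by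
  rw [phiHat, phiHatExt, besselKRatio_eq _ hσ,
    show (l : ℝ) + 3 / 2 = (l : ℝ) + 1 / 2 + 1 by ring]

theorem continuousOn_phiHatExt (l : ℕ) : ContinuousOn (p.phiHatExt l) (Ici 0) :=
  ((continuousOn_const.mul (continuousOn_besselKRatio (by simp))).sub continuousOn_const).add
    continuousOn_const

theorem tendsto_phiHat (l : ℕ) : Tendsto (p.phiHat l) (𝓝[>] 0) (𝓝 (p.phiHatExt l 0)) := by
  have h : Tendsto (p.phiHatExt l) (𝓝[>] 0) (𝓝 (p.phiHatExt l 0)) :=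
    (p.continuousOn_phiHatExt l 0 self_mem_Ici).mono_left (nhdsWithin_mono _ Ioi_subset_Ici_self)
  refine h.congr' ?_
  filter_upwards [self_mem_nhdsWithin] with σ hσ
  exact (p.phiHat_eq_phiHatExt l hσ).symm

theorem phiHatZero_eq_phiHatExt (l : ℕ) : p.phiHatZero l = p.phiHatExt l 0 :=
  rightLim_eq_of_tendsto (p.tendsto_phiHat l)

variable {p}

/-- At `σ = 0` the ratio of `K` functions is `2l + 1`; the numerator becomes the quantity bounded
below in (b). -/
theorem phiHatZero_eq (hβ : p.beta ≠ 2) (l : ℕ) : p.phiHatZero l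
    = ((p.beta - 2) ^ 2 + 2 * (l : ℝ) * (p.beta ^ 2 + 4) + p.w l) / (2 - p.beta) ^ 2 := by
  have : 2 - p.beta ≠ 0 := sub_ne_zero.2 hβ.symm
  rw [phiHatZero_eq_phiHatExt, phiHatExt, besselKRatio_zero]
  field_simp
  ring

/-- If `J_{l+1/2}` has no zeros in `(0, v₀]` and `φ_l(v₀) ≤ φ̂_l(0⁺)`, there is no bound state with
angular momentum `l`. -/
theorem not_isBoundState (hβ : p.beta ≠ 2) (hβ' : p.beta ≠ -2) {l : ℕ}
    (hA : ∀ x ∈ Ioc 0 p.v0, besselEntire ((l : ℝ) + 1 / 2) (x ^ 2) ≠ 0)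
    (hphi : phi l p.v0 ≤ p.phiHatZero l) {E : ℝ} {u : ℝ → ℂ} : ¬ p.IsBoundState l E u := by
  intro hb
  have hR := p.R_pos
  have hmu := p.mu_pos
  have hh := p.hbar_pos
  have hv := p.v0_pos
  have hE := hb.energy_neg
  set k : ℝ := p.v0 ^ 2 / p.R ^ 2
  set c : ℝ := 2 * p.mu / p.hbar ^ 2 * (-E)
  have hc : 0 < c := mul_pos (by positivity) (neg_pos.2 hE)
  have hkR : k * p.R ^ 2 = p.v0 ^ 2 := by simp only [k]; field_simp
  have hAr : ∀ r ∈ Ioc 0 p.R, besselEntire ((l : ℝ) + 1 / 2) (k * r ^ 2) ≠ 0 := by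
    intro r hr
    have h := hA (p.v0 / p.R * r) ⟨mul_pos (div_pos hv hR) hr.1, ?_⟩
    · rwa [mul_pow, div_pow] at h
    · rw [div_mul_eq_mul_div, div_le_iff₀ hR]
      exact mul_le_mul_of_nonneg_left hr.2 hv.le
  obtain ⟨um, dum, up, dup, hum, hdum, hup, hdup, hm1, hm2⟩ := hb.matching
  -- The equation and the matching have real coefficients, so a real functional of `u` satisfies
  -- them too; real and imaginary parts suffice.
  have hmain : ∀ f : ℂ →L[ℝ] ℝ, ∀ r, 0 < r → r ≠ p.R → f (u r) = 0 := by
    intro f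
    have hmul : ∀ (a : ℝ) (z : ℂ), f ((a : ℂ) * z) = a * f z := fun a z => by
      rw [← Complex.real_smul, map_smul, smul_eq_mul]
    have hu : ∀ r, 0 < r → r ≠ p.R → HasDerivAt (fun r => f (u r)) (f (deriv u r)) r :=
      fun r h1 h2 => f.hasFDerivAt.comp_hasDerivAt r (hb.differentiable r h1 h2).hasDerivAt
    have hu' : ∀ r, 0 < r → r ≠ p.R → HasDerivAt (fun r => f (deriv u r))
        (((l : ℝ) * ((l : ℝ) + 1) / r ^ 2
          + 2 * p.mu / p.hbar ^ 2 * (p.wellPotential r - E)) * f (u r)) r := fun r h1 h2 => by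
      rw [← hmul]
      exact f.hasFDerivAt.comp_hasDerivAt r (hb.schrodinger r h1 h2)
    have h0 : Tendsto (fun r => f (u r)) (𝓝[>] 0) (𝓝 0) := by
      simpa [Function.comp_def] using (f.continuous.tendsto 0).comp hb.origin
    have hlim : ∀ {F : Filter ℝ} {v : ℝ → ℂ} {z : ℂ}, Tendsto v F (𝓝 z) →
        Tendsto (fun r => f (v r)) F (𝓝 (f z)) := fun h => (f.continuous.tendsto _).comp h
    have hint : IntegrableOn (fun r => f (u r) ^ 2) (Ioi p.R) :=
      IntegrableOn.mono_set (f.comp_memLp' hb.square_integrable).integrable_sq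
        (Ioi_subset_Ioi hR.le)
    have hgR := (hasDerivAt_innerLogDeriv l k hR.ne' (hAr p.R ⟨hR, le_rfl⟩)).continuousAt.tendsto
    obtain ⟨hin, hin0⟩ := picone_nonneg_of_tendsto_zero (M := |2 * p.mu / p.hbar ^ 2 * (-p.V0 - E)|)
      (u := fun r => f (u r)) (u' := fun r => f (deriv u r)) (g := innerLogDeriv l k)
      (q := fun r => (l : ℝ) * ((l : ℝ) + 1) / r ^ 2 + 2 * p.mu / p.hbar ^ 2 * (-p.V0 - E))
      hR hc (fun r hr => hu r hr.1 hr.2.ne)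
      (fun r hr => by
        have := hu' r hr.1 hr.2.ne
        rwa [wellPotential, if_pos hr.2] at this)
      (fun r hr => by
        have h1 : 0 ≤ (l : ℝ) * ((l : ℝ) + 1) / r ^ 2 := by positivity
        have h2 := neg_abs_le (2 * p.mu / p.hbar ^ 2 * (-p.V0 - E))
        linarith)
      (fun r hr => by
        refine (hasDerivAt_innerLogDeriv l k hr.1.ne' (hAr r ⟨hr.1, hr.2.le⟩)).congr_deriv ?_
        simp only [k, c, v0_sq_div_R_sq]
        ring)
      h0
      (((hlim hum).mul (hlim hdum)).sub (((hlim hum).pow 2).mul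
        (hgR.mono_left nhdsWithin_le_nhds)))
    obtain ⟨hout, hout0⟩ := picone_nonpos_of_integrable_sq l
      (u := fun r => f (u r)) (u' := fun r => f (deriv u r))
      hR hc (fun r hr => hu r (hR.trans hr) (ne_of_gt hr))
      (fun r hr => by
        have := hu' r (hR.trans hr) (ne_of_gt hr)
        rw [wellPotential, if_neg (not_lt.2 (le_of_lt hr))] at this
        refine this.congr_deriv ?_
        simp only [c]
        ring)
      hint
      (((hlim hup).mul (hlim hdup)).sub (((hlim hup).pow 2).mul
        ((tendsto_const_nhds.div tendsto_id hR.ne').mono_left nhdsWithin_le_nhds)))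
    have hfup : f up = (2 + p.beta) / (2 - p.beta) * f um := by rw [hm1, hmul]
    have hfdup : f dup = 4 * p.alpha l / (4 - p.beta ^ 2) * f um
        + (2 - p.beta) / (2 + p.beta) * f dum := by rw [hm2, map_add, hmul, hmul]
    have hb1 : 2 - p.beta ≠ 0 := sub_ne_zero.2 hβ.symm
    have hb2 : 2 + p.beta ≠ 0 := fun h => hβ' (by linarith)
    have hb3 : 4 - p.beta ^ 2 ≠ 0 := by
      rw [show 4 - p.beta ^ 2 = (2 - p.beta) * (2 + p.beta) by ring]
      exact mul_ne_zero hb1 hb2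
    -- The jump of the Picone quantity at `R`: it is `≤ 0` by the two comparisons and `≥ 0` by
    -- `hphi`, so both boundary limits vanish.
    have hkey : (f up * f dup - f up ^ 2 * (-l / p.R))
        - (f um * f dum - f um ^ 2 * innerLogDeriv l k p.R)
        = f um ^ 2 * ((p.phiHatZero l - phi l p.v0) / p.R) := by
      rw [hfup, hfdup, phiHatZero_eq hβ, phi_eq l hv, innerLogDeriv, hkR, ← hkR, w,
        show 4 - p.beta ^ 2 = (2 - p.beta) * (2 + p.beta) by ring]
      field_simp
      ring
    have hpos : 0 ≤ f um ^ 2 * ((p.phiHatZero l - phi l p.v0) / p.R) :=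
      mul_nonneg (sq_nonneg _) (div_nonneg (sub_nonneg.2 hphi) hR.le)
    intro r hr hrR
    rcases lt_or_gt_of_ne hrR with h | h
    · exact hin0 (by linarith) r ⟨hr, h⟩
    · exact hout0 (by linarith) r h
  obtain ⟨r, hr, hrR, hne⟩ := hb.nonzero
  exact hne (Complex.ext (hmain Complex.reCLM r hr hrR) (hmain Complex.imCLM r hr hrR))

theorem not_isBoundState_of_notMem_admissible (hβ : p.beta ≠ 2) (hβ' : p.beta ≠ -2) {l : ℕ}
    (hl : l ∉ p.admissible) : ¬ ∃ (E : ℝ) (u : ℝ → ℂ), p.IsBoundState l E u := by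
  simp only [admissible, mem_ofPred_eq, not_or, not_lt, not_exists, not_and] at hl
  obtain ⟨h1, h2, h3⟩ := hl
  rintro ⟨E, u, hb⟩
  refine not_isBoundState hβ hβ' (fun x hx => ?_) h3 hb
  exact besselEntire_ne_zero_of_mem_Ioo l 0
    ⟨hx.1, hx.2.trans_lt (lt_of_le_of_ne h1 (h2 1 le_rfl))⟩

/-- Both series are controlled by their leading terms, and the ratio of these is `1 / (l + 3/2)`. -/
theorem tendsto_phi_atTop {x : ℝ} (hx : 0 < x) : Tendsto (fun l => phi l x) atTop (𝓝 0) := by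
  set e : ℕ → ℝ := fun l => Real.exp (x ^ 2 / (4 * (1 / 2 + (l : ℝ) + 1)))
  have he : Tendsto e atTop (𝓝 1) := tendsto_exp_div_natCast _ _
  have hbound : ∀ᶠ l : ℕ in atTop,
      ‖phi l x‖ ≤ x ^ 2 / 2 * (e l / (2 - e l)) * ((l : ℝ) + 1)⁻¹ := by
    filter_upwards [he.eventually (gt_mem_nhds one_lt_two)] with l hl
    have hν : (0 : ℝ) ≤ (l : ℝ) + 1 / 2 := by positivity
    have hG : 0 < Real.Gamma ((l : ℝ) + 1 / 2 + 1) := Real.Gamma_pos_of_pos (by positivity)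
    have hG1 : Real.Gamma ((l : ℝ) + 1 / 2 + 1 + 1)
        = ((l : ℝ) + 1 / 2 + 1) * Real.Gamma ((l : ℝ) + 1 / 2 + 1) :=
      Real.Gamma_add_one (by positivity)
    have hx2 : |x ^ 2| = x ^ 2 := abs_of_nonneg (sq_nonneg x)
    have h1 := (abs_le.1 (abs_besselEntire_sub_le hν (x ^ 2))).1
    have h2 := abs_le.1 (abs_besselEntire_sub_le
      (ν := (l : ℝ) + 1 / 2 + 1) (by positivity) (x ^ 2))
    rw [hx2, hG1] at h2
    rw [hx2] at h1
    have hee : Real.exp (x ^ 2 / (4 * ((l : ℝ) + 1 / 2 + 1))) = e l := by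
      simp only [e]; ring_nf
    have hee1 : Real.exp (x ^ 2 / (4 * ((l : ℝ) + 1 / 2 + 1 + 1))) ≤ e l := by
      rw [← hee]
      gcongr <;> norm_num
    rw [hee] at h1
    set G := Real.Gamma ((l : ℝ) + 1 / 2 + 1)
    set a := besselEntire ((l : ℝ) + 1 / 2) (x ^ 2)
    set b := besselEntire ((l : ℝ) + 1 / 2 + 1) (x ^ 2)
    have ha : (2 - e l) / G ≤ a := by
      have : (2 - e l) / G = 1 / G + -((e l - 1) / G) := by ring
      linarith
    have he0 : 0 < 2 - e l := by linarith
    have hel : 1 ≤ e l := Real.one_le_exp (by positivity)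
    have hb : |b| ≤ e l / (((l : ℝ) + 1) * G) := by
      have hp : 0 < ((l : ℝ) + 1 / 2 + 1) * G := by positivity
      have h4 : (Real.exp (x ^ 2 / (4 * ((l : ℝ) + 1 / 2 + 1 + 1))) - 1)
          / (((l : ℝ) + 1 / 2 + 1) * G) ≤ (e l - 1) / (((l : ℝ) + 1 / 2 + 1) * G) := by gcongr
      have h5 : e l / (((l : ℝ) + 1 / 2 + 1) * G)
          = 1 / (((l : ℝ) + 1 / 2 + 1) * G) + (e l - 1) / (((l : ℝ) + 1 / 2 + 1) * G) := by ring
      have h6 : e l / (((l : ℝ) + 1 / 2 + 1) * G) ≤ e l / (((l : ℝ) + 1) * G) := by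
        gcongr; linarith
      have h7 : 0 < 1 / (((l : ℝ) + 1 / 2 + 1) * G) := by positivity
      rw [abs_le]
      constructor <;> linarith
    have ha0 : 0 < (2 - e l) / G := by positivity
    rw [phi_eq l hx, norm_mul, Real.norm_of_nonneg (by positivity : 0 ≤ x ^ 2 / 2), norm_div,
      Real.norm_eq_abs, Real.norm_of_nonneg (ha0.le.trans ha), mul_assoc]
    gcongr
    calc |b| / a ≤ (e l / (((l : ℝ) + 1) * G)) / ((2 - e l) / G) := by gcongr
      _ = e l / (2 - e l) * ((l : ℝ) + 1)⁻¹ := by field_simp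
  refine squeeze_zero_norm' hbound ?_
  have h1 : Tendsto (fun l : ℕ => ((l : ℝ) + 1)⁻¹) atTop (𝓝 0) := by
    simpa using tendsto_one_div_add_atTop_nhds_zero_nat (𝕜 := ℝ)
  have h2 := (he.div (he.const_sub 2) (by norm_num)).const_mul (x ^ 2 / 2)
  simpa using h2.mul h1

theorem eventually_notMem_admissible (hβ : p.beta ≠ 2) {δ : ℝ} (hδ : 0 < δ)
    (h : ∀ᶠ l : ℕ in atTop,
      δ ≤ (p.beta - 2) ^ 2 + 2 * (l : ℝ) * (p.beta ^ 2 + 4) + p.w l) :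
    ∀ᶠ l : ℕ in atTop, l ∉ p.admissible := by
  have hv := p.v0_pos
  have hβ2 : 0 < (2 - p.beta) ^ 2 := by
    have : 2 - p.beta ≠ 0 := sub_ne_zero.2 hβ.symm
    positivity
  filter_upwards [h, (tendsto_exp_div_natCast (p.v0 ^ 2) (1 / 2)).eventually
    (gt_mem_nhds one_lt_two), (tendsto_phi_atTop hv).eventually
    (gt_mem_nhds (div_pos hδ hβ2))] with l h1 h2 h3
  have hne : ∀ x, 0 ≤ x → x ≤ p.v0 → besselEntire ((l : ℝ) + 1 / 2) (x ^ 2) ≠ 0 := by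
    intro x hx hxv
    refine (besselEntire_pos_of_exp_lt_two (by positivity) (lt_of_le_of_lt ?_ h2)).ne'
    rw [abs_of_nonneg (sq_nonneg x), add_comm (1 / 2 : ℝ)]
    gcongr
  rintro (h4 | ⟨s, hs, h4⟩ | h4)
  · exact hne _ (besselZero_nonneg l 1) h4.le (besselEntire_besselZero_succ l 0)
  · obtain ⟨s, rfl⟩ := Nat.exists_eq_add_of_le' hs
    exact hne _ (besselZero_nonneg l _) h4.ge (besselEntire_besselZero_succ l s)
  · rw [phiHatZero_eq hβ] at h4
    have : δ / (2 - p.beta) ^ 2 ≤ ((p.beta - 2) ^ 2 + 2 * (l : ℝ) * (p.beta ^ 2 + 4) + p.w l)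
      / (2 - p.beta) ^ 2 := by gcongr
    linarith

theorem exists_isGreatest_admissible (hβ : p.beta ≠ 2) {δ : ℝ} (hδ : 0 < δ)
    (h : ∀ᶠ l : ℕ in atTop,
      δ ≤ (p.beta - 2) ^ 2 + 2 * (l : ℝ) * (p.beta ^ 2 + 4) + p.w l)
    (hne : p.admissible.Nonempty) : ∃ lmax : ℕ, IsGreatest p.admissible lmax := by
  obtain ⟨N, hN⟩ := eventually_atTop.1 (eventually_notMem_admissible hβ hδ h)
  have hbdd : BddAbove p.admissible :=
    ⟨N, fun l hl => le_of_not_ge fun hNl => hN l hNl hl⟩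
  exact ⟨sSup p.admissible, Nat.sSup_mem hne hbdd, fun l hl => le_csSup hbdd hl⟩

end DeltaWell

/-! ### Sign changes and slopes at consecutive zeros -/

theorem exists_mem_Ioo_eq_zero_of_mul_neg {f : ℝ → ℝ} {a b : ℝ} (hab : a ≤ b)
    (hf : ContinuousOn f (Icc a b)) (h : f a * f b < 0) : ∃ c ∈ Ioo a b, f c = 0 := by
  rcases mul_neg_iff.1 h with ⟨h1, h2⟩ | ⟨h1, h2⟩
  · exact intermediate_value_Ioo' hab hf ⟨h2, h1⟩
  · exact intermediate_value_Ioo hab hf ⟨h1, h2⟩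

theorem forall_pos_or_forall_neg_of_ne_zero {f : ℝ → ℝ} {a b : ℝ} (hf : Continuous f)
    (h : ∀ x ∈ Ioo a b, f x ≠ 0) :
    (∀ x ∈ Ioo a b, 0 < f x) ∨ ∀ x ∈ Ioo a b, f x < 0 := by
  by_contra! hcon
  obtain ⟨⟨x, hx, hfx⟩, y, hy, hfy⟩ := hcon
  obtain ⟨c, hc, hc0⟩ := isPreconnected_Ioo.intermediate_value hx hy hf.continuousOn ⟨hfx, hfy⟩
  exact h c hc hc0

theorem HasDerivAt.nonpos_of_pos_left {f : ℝ → ℝ} {f' a b : ℝ} (hab : a < b)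
    (hf : HasDerivAt f f' b) (hb : f b = 0) (hpos : ∀ x ∈ Ioo a b, 0 < f x) : f' ≤ 0 := by
  refine le_of_tendsto (hf.tendsto_slope.mono_left
    (nhdsWithin_mono b (show Iio b ⊆ {b}ᶜ from fun x hx => ne_of_lt hx))) ?_
  filter_upwards [Ioo_mem_nhdsLT hab] with x hx
  rw [slope_def_field, hb, sub_zero]
  exact (div_neg_of_pos_of_neg (hpos x hx) (sub_neg.2 hx.2)).le

theorem HasDerivAt.nonneg_of_pos_right {f : ℝ → ℝ} {f' a b : ℝ} (hab : a < b)
    (hf : HasDerivAt f f' a) (ha : f a = 0) (hpos : ∀ x ∈ Ioo a b, 0 < f x) : 0 ≤ f' := by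
  refine ge_of_tendsto (hf.tendsto_slope.mono_left
    (nhdsWithin_mono a (show Ioi a ⊆ {a}ᶜ from fun x hx => ne_of_gt hx))) ?_
  filter_upwards [Ioo_mem_nhdsGT hab] with x hx
  rw [slope_def_field, ha, sub_zero]
  exact (div_pos (hpos x hx) (sub_pos.2 hx.1)).le

theorem HasDerivAt.mul_nonpos_of_consecutive_zeros {f : ℝ → ℝ} {f'a f'b a b : ℝ} (hab : a < b)
    (hc : Continuous f) (hfa : HasDerivAt f f'a a) (hfb : HasDerivAt f f'b b)
    (ha : f a = 0) (hb : f b = 0) (h : ∀ x ∈ Ioo a b, f x ≠ 0) : f'a * f'b ≤ 0 := by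
  rcases forall_pos_or_forall_neg_of_ne_zero hc h with h | h
  · exact mul_nonpos_of_nonneg_of_nonpos (hfa.nonneg_of_pos_right hab ha h)
      (hfb.nonpos_of_pos_left hab hb h)
  · have h1 := hfa.neg.nonneg_of_pos_right hab (by simp [ha]) fun x hx => neg_pos.2 (h x hx)
    have h2 := hfb.neg.nonpos_of_pos_left hab (by simp [hb]) fun x hx => neg_pos.2 (h x hx)
    nlinarith

/-! ### Explicit inner and outer solutions -/

/-- The regular solution of `u'' = (l (l + 1) / r ^ 2 - k) u`. -/
noncomputable def innerSolution (l : ℕ) (k r : ℝ) : ℝ :=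
  r ^ (l + 1) * besselEntire ((l : ℝ) + 1 / 2) (k * r ^ 2)

/-- The derivative of `innerSolution`. -/
noncomputable def innerSolutionDeriv (l : ℕ) (k r : ℝ) : ℝ :=
  (l + 1) * r ^ l * besselEntire ((l : ℝ) + 1 / 2) (k * r ^ 2)
    - k / 2 * r ^ (l + 2) * besselEntire ((l : ℝ) + 1 / 2 + 1) (k * r ^ 2)

theorem continuous_innerSolution (l : ℕ) (k : ℝ) : Continuous (innerSolution l k) := by
  have := continuous_besselEntire (ν := (l : ℝ) + 1 / 2) (by positivity)
  unfold innerSolution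
  fun_prop

theorem hasDerivAt_innerSolution (l : ℕ) (k r : ℝ) :
    HasDerivAt (innerSolution l k) (innerSolutionDeriv l k r) r := by
  refine ((hasDerivAt_pow (l + 1) r).mul
    (hasDerivAt_besselEntire_mul_sq (by positivity) k r)).congr_deriv ?_
  simp only [innerSolutionDeriv, Nat.add_sub_cancel]
  push_cast
  ring

/-- The sign of `k` is free, so energies above and below the bottom of the well need no separate
treatment. The recurrence eliminates `A_{l+5/2}`. -/
theorem hasDerivAt_innerSolutionDeriv (l : ℕ) (k : ℝ) {r : ℝ} (hr : 0 < r) :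
    HasDerivAt (innerSolutionDeriv l k)
      (((l : ℝ) * (l + 1) / r ^ 2 - k) * innerSolution l k r) r := by
  have hν : (0 : ℝ) ≤ (l : ℝ) + 1 / 2 := by positivity
  have hp : HasDerivAt (fun r : ℝ => ((l : ℝ) + 1) * r ^ l) ((l + 1) * (l / r * r ^ l)) r := by
    refine ((hasDerivAt_pow l r).const_mul ((l : ℝ) + 1)).congr_deriv ?_
    rcases l with _ | l
    · simp
    · rw [pow_succ]
      push_cast
      field_simp
  have h3 := besselEntire_recurrence hν (k * r ^ 2)
  refine ((hp.mul (hasDerivAt_besselEntire_mul_sq hν k r)).sub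
    (((hasDerivAt_pow (l + 2) r).const_mul (k / 2)).mul
      (hasDerivAt_besselEntire_mul_sq (ν := (l : ℝ) + 1 / 2 + 1) (by positivity) k r))).congr_deriv
    ?_
  simp only [innerSolution]
  set a := besselEntire ((l : ℝ) + 1 / 2) (k * r ^ 2)
  set b := besselEntire ((l : ℝ) + 1 / 2 + 1) (k * r ^ 2)
  set e := besselEntire ((l : ℝ) + 1 / 2 + 1 + 1) (k * r ^ 2)
  rw [show l + 2 - 1 = l + 1 by omega, pow_succ r (l + 1), pow_succ r l]
  push_cast
  field_simp
  linear_combination (4 * k * r ^ 2) * h3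

/-- The solution of `u'' = (l (l + 1) / r ^ 2 + κ ^ 2) u` that decays at infinity. -/
noncomputable def outerSolution (l : ℕ) (κ r : ℝ) : ℝ :=
  √r * besselK ((l : ℝ) + 1 / 2) (κ * r)

/-- The derivative of `outerSolution`. -/
noncomputable def outerSolutionDeriv (l : ℕ) (κ r : ℝ) : ℝ :=
  (l + 1) / r * outerSolution l κ r - κ * (√r * besselK ((l : ℝ) + 1 / 2 + 1) (κ * r))

theorem hasDerivAt_outerSolution (l : ℕ) {κ r : ℝ} (hκ : 0 < κ) (hr : 0 < r) :
    HasDerivAt (outerSolution l κ) (outerSolutionDeriv l κ r) r := by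
  have hK := (hasDerivAt_besselK ((l : ℝ) + 1 / 2) (mul_pos hκ hr)).comp r
    ((hasDerivAt_id r).const_mul κ)
  refine ((Real.hasDerivAt_sqrt hr.ne').mul hK).congr_deriv ?_
  simp only [outerSolutionDeriv, outerSolution, Function.comp_apply]
  have h2 : √r ^ 2 = r := Real.sq_sqrt hr.le
  have h3 : 0 < √r := Real.sqrt_pos.2 hr
  have h4 : 1 / (2 * √r) = √r / (2 * r) := by
    rw [div_eq_div_iff (by positivity) (by positivity)]
    linear_combination (-2) * h2
  rw [h4]
  field_simp
  ring

theorem hasDerivAt_outerSolutionDeriv (l : ℕ) {κ r : ℝ} (hκ : 0 < κ) (hr : 0 < r) :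
    HasDerivAt (outerSolutionDeriv l κ)
      (((l : ℝ) * (l + 1) / r ^ 2 + κ ^ 2) * outerSolution l κ r) r := by
  have hK := (hasDerivAt_besselK_add_one ((l : ℝ) + 1 / 2) (mul_pos hκ hr)).comp r
    ((hasDerivAt_id r).const_mul κ)
  refine ((((hasDerivAt_const r ((l : ℝ) + 1)).div (hasDerivAt_id r) hr.ne').mul
    (hasDerivAt_outerSolution l hκ hr)).sub
    (((Real.hasDerivAt_sqrt hr.ne').mul hK).const_mul κ)).congr_deriv ?_
  simp only [outerSolutionDeriv, outerSolution, Function.comp_apply, id, Pi.div_apply]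
  have h2 : √r ^ 2 = r := Real.sq_sqrt hr.le
  have h3 : 0 < √r := Real.sqrt_pos.2 hr
  have h4 : 1 / (2 * √r) = √r / (2 * r) := by
    rw [div_eq_div_iff (by positivity) (by positivity)]
    linear_combination (-2) * h2
  rw [h4]
  field_simp
  ring

/-- The square of `K` decays like `exp (-2 κ r)`; one of the two exponentials absorbs the factor `r
≤ exp (κ r) / κ`. -/
theorem integrableOn_outerSolution_sq (l : ℕ) {κ R : ℝ} (hκ : 0 < κ) (hR : 0 < R) :
    IntegrableOn (fun r => outerSolution l κ r ^ 2) (Ioi R) := by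
  have hcont : ContinuousOn (fun r => outerSolution l κ r ^ 2) (Ici R) := fun r hr =>
    ((hasDerivAt_outerSolution l hκ (hR.trans_le hr)).continuousAt.pow 2).continuousWithinAt
  refine integrable_of_isBigO_exp_neg hκ hcont ?_
  set K := besselK ((l : ℝ) + 1 / 2) (κ * R)
  refine Asymptotics.IsBigO.of_bound (Real.exp (κ * R) ^ 2 * K ^ 2 / κ) ?_
  filter_upwards [eventually_ge_atTop R] with r hr
  have hr0 : 0 < r := hR.trans_le hr
  have h1 : besselK ((l : ℝ) + 1 / 2) (κ * r) ≤ Real.exp (-(κ * r - κ * R)) * K :=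
    besselK_le_exp_mul (mul_pos hκ hR) (by gcongr)
  have h2 := besselK_pos ((l : ℝ) + 1 / 2) (mul_pos hκ hr0)
  have h3 : κ * r ≤ Real.exp (κ * r) := by
    have := Real.add_one_le_exp (κ * r)
    linarith
  have h4 : Real.exp (-(κ * r - κ * R)) = Real.exp (-κ * r) * Real.exp (κ * R) := by
    rw [← Real.exp_add]; ring_nf
  have h5 : Real.exp (κ * r) * Real.exp (-κ * r) = 1 := by
    rw [← Real.exp_add]; simp
  rw [Real.norm_of_nonneg (sq_nonneg _), Real.norm_of_nonneg (Real.exp_pos _).le, outerSolution,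
    mul_pow, Real.sq_sqrt hr0.le]
  calc r * besselK ((l : ℝ) + 1 / 2) (κ * r) ^ 2
      ≤ (Real.exp (κ * r) / κ) * (Real.exp (-κ * r) * Real.exp (κ * R) * K) ^ 2 := by
        rw [← h4]
        gcongr
        rw [le_div_iff₀ hκ]
        linarith
    _ = Real.exp (κ * R) ^ 2 * K ^ 2 / κ * Real.exp (-κ * r)
        * (Real.exp (κ * r) * Real.exp (-κ * r)) := by ring
    _ = _ := by rw [h5, mul_one]

/-! ### Bound states from zeros of the secular function -/

namespace DeltaWell

variable {p : DeltaWell}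

/-- Both pieces solve their equations on all of `(0, ∞)`, so the one-sided limits at `R` are plain
values. -/
theorem isBoundState_of_real {l : ℕ} {E : ℝ} {a a' b b' : ℝ → ℝ} (hE : E < 0)
    (ha : ∀ r, 0 < r → HasDerivAt a (a' r) r)
    (ha' : ∀ r, 0 < r → HasDerivAt a' (((l : ℝ) * ((l : ℝ) + 1) / r ^ 2
      + 2 * p.mu / p.hbar ^ 2 * (-p.V0 - E)) * a r) r)
    (hb : ∀ r, 0 < r → HasDerivAt b (b' r) r)
    (hb' : ∀ r, 0 < r → HasDerivAt b' (((l : ℝ) * ((l : ℝ) + 1) / r ^ 2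
      + 2 * p.mu / p.hbar ^ 2 * (0 - E)) * b r) r)
    (hcont : Continuous a) (h0 : a 0 = 0) (hne : ∃ r ∈ Ioo 0 p.R, a r ≠ 0)
    (hint : IntegrableOn (fun r => b r ^ 2) (Ioi p.R))
    (hm : b p.R = (2 + p.beta) / (2 - p.beta) * a p.R)
    (hm' : b' p.R = 4 * p.alpha l / (4 - p.beta ^ 2) * a p.R
      + (2 - p.beta) / (2 + p.beta) * a' p.R) :
    p.IsBoundState l E (fun r => ((if r < p.R then a r else b r : ℝ) : ℂ)) := by
  have hR := p.R_pos
  set u : ℝ → ℝ := fun r => if r < p.R then a r else b r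
  set u' : ℝ → ℝ := fun r => if r < p.R then a' r else b' r
  have hul : ∀ r, r < p.R → u =ᶠ[𝓝 r] a ∧ u' =ᶠ[𝓝 r] a' := fun r hr => by
    constructor <;> filter_upwards [Iio_mem_nhds hr] with s hs using if_pos hs
  have hur : ∀ r, p.R < r → u =ᶠ[𝓝 r] b ∧ u' =ᶠ[𝓝 r] b' := fun r hr => by
    constructor <;> filter_upwards [Ioi_mem_nhds hr] with s hs using if_neg (not_lt.2 (le_of_lt hs))
  have hu : ∀ r, 0 < r → r ≠ p.R → HasDerivAt u (u' r) r := fun r h1 h2 => by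
    rcases lt_or_gt_of_ne h2 with h | h
    · exact ((ha r h1).congr_of_eventuallyEq (hul r h).1).congr_deriv (hul r h).2.self_of_nhds.symm
    · exact ((hb r h1).congr_of_eventuallyEq (hur r h).1).congr_deriv (hur r h).2.self_of_nhds.symm
  have hu' : ∀ r, 0 < r → r ≠ p.R → HasDerivAt u' (((l : ℝ) * ((l : ℝ) + 1) / r ^ 2
      + 2 * p.mu / p.hbar ^ 2 * (p.wellPotential r - E)) * u r) r := fun r h1 h2 => by
    rcases lt_or_gt_of_ne h2 with h | h
    · rw [(hul r h).1.self_of_nhds, wellPotential, if_pos h]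
      exact (ha' r h1).congr_of_eventuallyEq (hul r h).2
    · rw [(hur r h).1.self_of_nhds, wellPotential, if_neg h.not_gt]
      exact (hb' r h1).congr_of_eventuallyEq (hur r h).2
  have hderiv : ∀ r, 0 < r → r ≠ p.R →
      deriv (fun r => (u r : ℂ)) =ᶠ[𝓝 r] fun r => (u' r : ℂ) := fun r h1 h2 => by
    filter_upwards [Ioi_mem_nhds h1, isOpen_ne.mem_nhds h2] with s hs hs2
    exact (hu s hs hs2).ofReal_comp.deriv
  have hofReal : ∀ {F : Filter ℝ} {v : ℝ → ℝ} {x : ℝ}, Tendsto v F (𝓝 x) →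
      Tendsto (fun r => (v r : ℂ)) F (𝓝 (x : ℂ)) := fun h =>
    (Complex.continuous_ofReal.tendsto _).comp h
  refine ⟨hE, ?_, ?_, ?_, fun r h1 h2 => (hu r h1 h2).ofReal_comp.differentiableAt,
    fun r h1 h2 => ?_, a p.R, a' p.R, b p.R, b' p.R, hofReal ?_, ?_, hofReal ?_, ?_, ?_, ?_⟩
  · obtain ⟨r, hr, hr0⟩ := hne
    refine ⟨r, hr.1, hr.2.ne, ?_⟩
    simpa [u, hr.2] using hr0
  · have hsplit : Ioi (0 : ℝ) = Ioo 0 p.R ∪ Ici p.R := (Ioo_union_Ici_eq_Ioi hR).symm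
    have heql : EqOn u a (Ioo 0 p.R) := fun r hr => if_pos hr.2
    have heqr : EqOn u b (Ici p.R) := fun r hr => if_neg (not_lt.2 hr)
    have hbc : ContinuousOn b (Ici p.R) := fun r hr =>
      (hb r (hR.trans_le hr)).continuousAt.continuousWithinAt
    have hmeas : AEStronglyMeasurable u (volume.restrict (Ioi (0 : ℝ))) := by
      rw [hsplit, aestronglyMeasurable_union_iff]
      exact ⟨(hcont.continuousOn.congr heql).aestronglyMeasurable measurableSet_Ioo,
        (hbc.congr heqr).aestronglyMeasurable measurableSet_Ici⟩
    refine MemLp.ofReal ((memLp_two_iff_integrable_sq hmeas).2 ?_)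
    change IntegrableOn (fun r => u r ^ 2) (Ioi 0)
    rw [hsplit]
    refine IntegrableOn.union ?_ ?_
    · refine IntegrableOn.congr_fun (f := fun r => a r ^ 2) ?_
        (fun r hr => by rw [heql hr]) measurableSet_Ioo
      exact ((hcont.pow 2).continuousOn.integrableOn_Icc).mono_set Ioo_subset_Icc_self
    · refine IntegrableOn.congr_fun (f := fun r => b r ^ 2) ?_
        (fun r hr => by rw [heqr hr]) measurableSet_Ici
      rwa [integrableOn_Ici_iff_integrableOn_Ioi]
  · rw [← Complex.ofReal_zero]
    refine hofReal ?_
    have : Tendsto a (𝓝[>] 0) (𝓝 0) := by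
      simpa [h0] using (hcont.tendsto 0).mono_left nhdsWithin_le_nhds
    exact this.congr' (((hul 0 hR).1.filter_mono nhdsWithin_le_nhds).symm)
  · rw [← Complex.ofReal_mul]
    exact (hu' r h1 h2).ofReal_comp.congr_of_eventuallyEq (hderiv r h1 h2)
  · refine ((ha p.R hR).continuousAt.tendsto.mono_left nhdsWithin_le_nhds).congr' ?_
    filter_upwards [self_mem_nhdsWithin] with r hr using (if_pos hr).symm
  · refine (hofReal ((ha' p.R hR).continuousAt.tendsto.mono_left
      (nhdsWithin_le_nhds (s := Iio p.R)))).congr' ?_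
    filter_upwards [Ioo_mem_nhdsLT hR] with r hr
    rw [(hderiv r hr.1 hr.2.ne).self_of_nhds]
    simp only [(hul r hr.2).2.self_of_nhds]
  · refine ((hb p.R hR).continuousAt.tendsto.mono_left nhdsWithin_le_nhds).congr' ?_
    filter_upwards [self_mem_nhdsWithin] with r hr using (if_neg (not_lt.2 (le_of_lt hr))).symm
  · refine (hofReal ((hb' p.R hR).continuousAt.tendsto.mono_left
      (nhdsWithin_le_nhds (s := Ioi p.R)))).congr' ?_
    filter_upwards [self_mem_nhdsWithin] with r hr
    rw [(hderiv r (hR.trans hr) (ne_of_gt hr)).self_of_nhds]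
    simp only [(hur r hr).2.self_of_nhds]
  · rw [hm, Complex.ofReal_mul]
  · rw [hm', Complex.ofReal_add, Complex.ofReal_mul, Complex.ofReal_mul]

/-- The secular function, in the variable `z = χ ^ 2 = v₀ ^ 2 - σ ^ 2`; for `z > 0` it is
`φ̂_l(σ) - φ_l(χ)` times `A_{l+1/2}(z)`. -/
noncomputable def secular (p : DeltaWell) (l : ℕ) (z : ℝ) : ℝ :=
  besselEntire ((l : ℝ) + 1 / 2) z * p.phiHatExt l √(p.v0 ^ 2 - z)
    - z / 2 * besselEntire ((l : ℝ) + 1 / 2 + 1) z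

/-- The real square root is `0` for `z > v₀²`, which keeps the argument in the half-line where
`phiHatExt` is continuous. -/
theorem continuous_secular (l : ℕ) : Continuous (p.secular l) := by
  have h1 := continuous_besselEntire (ν := (l : ℝ) + 1 / 2) (by positivity)
  have h2 := continuous_besselEntire (ν := (l : ℝ) + 1 / 2 + 1) (by positivity)
  have h3 : Continuous fun z => p.phiHatExt l √(p.v0 ^ 2 - z) :=
    (p.continuousOn_phiHatExt l).comp_continuous (by fun_prop) fun z => Real.sqrt_nonneg _
  unfold secular
  fun_prop

/-- The constant `C` is fixed by matching the values at `R`; matching the derivatives is then the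
secular equation. -/
theorem exists_isBoundState_of_secular_eq_zero (hβ : p.beta ≠ 2) (hβ' : p.beta ≠ -2) {l : ℕ}
    {z : ℝ} (hz : z < p.v0 ^ 2) (h : p.secular l z = 0) :
    ∃ (E : ℝ) (u : ℝ → ℂ), p.IsBoundState l E u ∧ (0 < z → -p.V0 < E) := by
  have hR := p.R_pos
  have hmu := p.mu_pos
  have hh := p.hbar_pos
  have hV := p.V0_pos
  have hν : (0 : ℝ) ≤ (l : ℝ) + 1 / 2 := by positivity
  set σ := √(p.v0 ^ 2 - z)
  have hσ : 0 < σ := Real.sqrt_pos.2 (sub_pos.2 hz)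
  have hσ2 : σ ^ 2 = p.v0 ^ 2 - z := Real.sq_sqrt (sub_pos.2 hz).le
  set k := z / p.R ^ 2
  set κ := σ / p.R
  have hκ : 0 < κ := div_pos hσ hR
  have hκR : κ * p.R = σ := by simp only [κ]; field_simp
  have hkR : k * p.R ^ 2 = z := by simp only [k]; field_simp
  set E := p.hbar ^ 2 * z / (2 * p.mu * p.R ^ 2) - p.V0
  have hk : 2 * p.mu / p.hbar ^ 2 * (-p.V0 - E) = -k := by
    simp only [E, k]; field_simp; ring
  have hκ2 : 2 * p.mu / p.hbar ^ 2 * (0 - E) = κ ^ 2 := by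
    have h1 := p.v0_sq_div_R_sq
    have h2 : κ ^ 2 = p.v0 ^ 2 / p.R ^ 2 - z / p.R ^ 2 := by
      simp only [κ]; rw [div_pow, hσ2, sub_div]
    rw [h2, h1]
    simp only [E]
    field_simp
    ring
  have hE : E < 0 := by
    have h1 : 0 < 2 * p.mu / p.hbar ^ 2 * (0 - E) := by rw [hκ2]; positivity
    have h2 := pos_of_mul_pos_right h1 (by positivity)
    linarith
  set C := (2 + p.beta) / (2 - p.beta) * innerSolution l k p.R / outerSolution l κ p.R
  have hKσ := besselK_pos ((l : ℝ) + 1 / 2) hσ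
  have hsq : 0 < √p.R := Real.sqrt_pos.2 hR
  have hout : 0 < outerSolution l κ p.R := by
    rw [outerSolution, hκR]; positivity
  refine ⟨E, _, isBoundState_of_real hE (a := innerSolution l k) (a' := innerSolutionDeriv l k)
    (b := fun r => C * outerSolution l κ r) (b' := fun r => C * outerSolutionDeriv l κ r)
    (fun r _ => hasDerivAt_innerSolution l k r) (fun r hr => ?_)
    (fun r hr => (hasDerivAt_outerSolution l hκ hr).const_mul C) (fun r hr => ?_)
    (continuous_innerSolution l k) (by simp [innerSolution]) ?_ ?_ ?_ ?_, fun hz0 => ?_⟩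
  · rw [hk]
    exact hasDerivAt_innerSolutionDeriv l k hr
  · rw [hκ2]
    exact ((hasDerivAt_outerSolutionDeriv l hκ hr).const_mul C).congr_deriv (by ring)
  · have h1 : Tendsto (fun r => besselEntire ((l : ℝ) + 1 / 2) (k * r ^ 2)) (𝓝[>] 0)
        (𝓝 (besselEntire ((l : ℝ) + 1 / 2) 0)) := by
      have h2 := (hasDerivAt_besselEntire_mul_sq hν k 0).continuousAt.tendsto
      simp only [ne_eq, OfNat.ofNat_ne_zero, not_false_eq_true, zero_pow, mul_zero] at h2
      exact h2.mono_left nhdsWithin_le_nhds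
    obtain ⟨r, hr, hrR⟩ := ((h1.eventually
      (lt_mem_nhds (besselEntire_pos_of_nonpos hν le_rfl))).and (Ioo_mem_nhdsGT hR)).exists
    exact ⟨r, hrR, mul_ne_zero (pow_ne_zero _ hrR.1.ne') hr.ne'⟩
  · simp only [mul_pow]
    exact (integrableOn_outerSolution_sq l hκ hR).const_mul (C ^ 2)
  · exact div_mul_cancel₀ _ hout.ne'
  · have hb1 : 2 - p.beta ≠ 0 := sub_ne_zero.2 hβ.symm
    have hb2 : 2 + p.beta ≠ 0 := fun h => hβ' (by linarith)
    have h1 : C * outerSolutionDeriv l κ p.R = (2 + p.beta) / (2 - p.beta) * innerSolution l k p.R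
        * ((l + 1 - besselKRatio ((l : ℝ) + 1 / 2) σ) / p.R) := by
      rw [besselKRatio_eq _ hσ]
      simp only [C, outerSolutionDeriv, outerSolution, hκR]
      simp only [κ]
      generalize besselK ((l : ℝ) + 1 / 2) σ = K at hKσ ⊢
      generalize besselK ((l : ℝ) + 1 / 2 + 1) σ = K'
      field_simp
    -- This is the secular equation as a statement on the inner logarithmic derivative, kept free of
    -- division by `A_{l+1/2}(z)`.
    have h2 : innerSolutionDeriv l k p.R
        = innerSolution l k p.R * ((l + 1 - p.phiHatExt l σ) / p.R) := by
      have h3 : p.phiHatExt l σ * besselEntire ((l : ℝ) + 1 / 2) z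
          = k * p.R ^ 2 / 2 * besselEntire ((l : ℝ) + 1 / 2 + 1) z := by
        rw [secular] at h
        rw [hkR]
        linarith
      simp only [innerSolutionDeriv, innerSolution, hkR]
      generalize besselEntire ((l : ℝ) + 1 / 2) z = A at h3 ⊢
      generalize besselEntire ((l : ℝ) + 1 / 2 + 1) z = B at h3 ⊢
      clear_value k
      field_simp
      linear_combination (2 * p.R ^ (l + 1)) * h3
    rw [h1, h2, phiHatExt, w, show 4 - p.beta ^ 2 = (2 - p.beta) * (2 + p.beta) by ring]
    field_simp
    ring
  · have : 0 < p.hbar ^ 2 * z / (2 * p.mu * p.R ^ 2) := by positivity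
    simp only [E]
    linarith

/-- The ratio of `K` functions is at least `σ`, and its coefficient is positive because `β ≠ -2`. -/
theorem exists_phiHatExt_pos (hβ' : p.beta ≠ -2) (hβ : p.beta ≠ 2) (l : ℕ) :
    ∃ σ, p.v0 ≤ σ ∧ 0 < p.phiHatExt l σ := by
  have hb1 : 2 - p.beta ≠ 0 := sub_ne_zero.2 hβ.symm
  have hb2 : 2 + p.beta ≠ 0 := fun h => hβ' (by linarith)
  set c := (2 + p.beta) ^ 2 / (2 - p.beta) ^ 2
  have hc : 0 < c := by positivity
  set d := 8 * p.beta * ((l : ℝ) + 1) / (2 - p.beta) ^ 2 - p.w l / (2 - p.beta) ^ 2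
  refine ⟨max p.v0 ((d + 1) / c), le_max_left _ _, ?_⟩
  set σ := max p.v0 ((d + 1) / c)
  have h1 : σ ≤ besselKRatio ((l : ℝ) + 1 / 2) σ :=
    le_besselKRatio (by positivity) (p.v0_pos.trans_le (le_max_left _ _))
  have h2 : d + 1 ≤ c * besselKRatio ((l : ℝ) + 1 / 2) σ := by
    have := (le_max_right p.v0 ((d + 1) / c)).trans h1
    rw [div_le_iff₀ hc] at this
    linarith
  have h3 : p.phiHatExt l σ = c * besselKRatio ((l : ℝ) + 1 / 2) σ - d := by
    simp only [phiHatExt, c, d]; ring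
  linarith

theorem exists_isBoundState_of_v0_eq_besselZero (hβ : p.beta ≠ 2) (hβ' : p.beta ≠ -2) (l s : ℕ)
    (hv : p.v0 = besselZero ((l : ℝ) + 1 / 2) (s + 1)) :
    ∃ (E : ℝ) (u : ℝ → ℂ), p.IsBoundState l E u ∧
      (2 ≤ s + 1 ∨ 0 < p.phiHat l p.v0 → -p.V0 < E) := by
  have hv0 := p.v0_pos
  have hν : (0 : ℝ) ≤ (l : ℝ) + 1 / 2 := by positivity
  have hcA := continuous_besselEntire hν
  have hzero : besselEntire ((l : ℝ) + 1 / 2) (p.v0 ^ 2) = 0 :=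
    hv ▸ besselEntire_besselZero_succ l s
  have hB := besselEntire_add_one_ne_zero hν hzero
  set t := besselZero ((l : ℝ) + 1 / 2) s
  have ht0 : 0 ≤ t := besselZero_nonneg l s
  have htv : t < p.v0 := hv ▸ besselZero_lt_succ l s
  have htv2 : t ^ 2 < p.v0 ^ 2 := by gcongr
  have hne : ∀ z ∈ Ioo (t ^ 2) (p.v0 ^ 2), besselEntire ((l : ℝ) + 1 / 2) z ≠ 0 := by
    intro z hz
    have hz0 : 0 ≤ z := (sq_nonneg t).trans hz.1.le
    have := besselEntire_ne_zero_of_mem_Ioo l s (x := √z)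
      ⟨Real.lt_sqrt_of_sq_lt hz.1, hv ▸ (Real.sqrt_lt' hv0).2 hz.2⟩
    rwa [Real.sq_sqrt hz0] at this
  have hdv := hasDerivAt_besselEntire hν (p.v0 ^ 2)
  have hsec : p.secular l (p.v0 ^ 2)
      = -(p.v0 ^ 2 / 2) * besselEntire ((l : ℝ) + 1 / 2 + 1) (p.v0 ^ 2) := by
    rw [secular, hzero]; ring
  rcases Nat.eq_zero_or_pos s with rfl | hs
  · have ht : t = 0 := rfl
    rw [ht, zero_pow two_ne_zero] at hne
    have hpos0 : 0 < besselEntire ((l : ℝ) + 1 / 2) 0 := besselEntire_pos_of_nonpos hν le_rfl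
    have hApos : ∀ z ∈ Ioo 0 (p.v0 ^ 2), 0 < besselEntire ((l : ℝ) + 1 / 2) z := by
      intro z hz
      by_contra! hle
      obtain ⟨c, hc, hc0⟩ := exists_mem_Ioo_eq_zero_of_mul_neg hz.1.le hcA.continuousOn
        (mul_neg_of_pos_of_neg hpos0 (lt_of_le_of_ne hle (hne z hz)))
      exact hne c ⟨hc.1, hc.2.trans hz.2⟩ hc0
    have hBpos : 0 < besselEntire ((l : ℝ) + 1 / 2 + 1) (p.v0 ^ 2) := by
      have := hdv.nonpos_of_pos_left (by positivity) hzero hApos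
      exact lt_of_le_of_ne (by linarith) hB.symm
    -- The left endpoint is `z = v₀² - σ² ≤ 0`, where `secular` is positive. When `φ̂_l(v₀) > 0`,
    -- taking `σ = v₀` puts it at `0` and forces a root `z > 0`, that is `E > -V₀`.
    obtain ⟨σ, hσv, hσpos, hσ⟩ : ∃ σ, p.v0 ≤ σ ∧ 0 < p.phiHatExt l σ ∧
        (0 < p.phiHat l p.v0 → σ = p.v0) := by
      by_cases hp : 0 < p.phiHat l p.v0
      · exact ⟨p.v0, le_rfl, p.phiHat_eq_phiHatExt l hv0 ▸ hp, fun _ => rfl⟩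
      · obtain ⟨σ, h1, h2⟩ := exists_phiHatExt_pos hβ' hβ l
        exact ⟨σ, h1, h2, fun h => absurd h hp⟩
    have hσ0 : 0 < σ := hv0.trans_le hσv
    have hlo : p.v0 ^ 2 - σ ^ 2 ≤ 0 := sub_nonpos.2 (by gcongr)
    have hseclo : 0 < p.secular l (p.v0 ^ 2 - σ ^ 2) := by
      have h1 := besselEntire_pos_of_nonpos hν hlo
      have h2 := besselEntire_pos_of_nonpos (ν := (l : ℝ) + 1 / 2 + 1) (by positivity) hlo
      rw [secular, sub_sub_cancel, Real.sqrt_sq hσ0.le]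
      nlinarith [mul_pos h1 hσpos, mul_nonneg (neg_nonneg.2 hlo) h2.le]
    have hsecv : p.secular l (p.v0 ^ 2) < 0 := by
      rw [hsec]
      have : 0 < p.v0 ^ 2 / 2 * besselEntire ((l : ℝ) + 1 / 2 + 1) (p.v0 ^ 2) := by positivity
      linarith
    obtain ⟨z, hz, hz0⟩ := exists_mem_Ioo_eq_zero_of_mul_neg
      (hlo.trans (sq_nonneg p.v0)) (continuous_secular l).continuousOn
      (mul_neg_of_pos_of_neg hseclo hsecv)
    obtain ⟨E, u, hb, hE⟩ := exists_isBoundState_of_secular_eq_zero hβ hβ' hz.2 hz0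
    refine ⟨E, u, hb, fun h => hE ?_⟩
    have hp : 0 < p.phiHat l p.v0 := h.resolve_left (by norm_num)
    have := hz.1
    rwa [hσ hp, sub_self] at this
  · obtain ⟨s, rfl⟩ := Nat.exists_eq_add_of_le' hs
    have ht : 0 < t := (besselZero_nonneg l s).trans_lt (besselZero_lt_succ l s)
    have hzt : besselEntire ((l : ℝ) + 1 / 2) (t ^ 2) = 0 := besselEntire_besselZero_succ l s
    have hBt := besselEntire_add_one_ne_zero hν hzt
    -- `A_ν` has slopes of opposite sign at consecutive zeros, so `A_{ν+1}` and hence `secular`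
    -- change sign between `t²` and `v₀²`. Strictness comes from simplicity of the zeros.
    have hprod := (hasDerivAt_besselEntire hν (t ^ 2)).mul_nonpos_of_consecutive_zeros htv2 hcA hdv
      hzt hzero hne
    have hprod' : besselEntire ((l : ℝ) + 1 / 2 + 1) (t ^ 2)
        * besselEntire ((l : ℝ) + 1 / 2 + 1) (p.v0 ^ 2) < 0 :=
      lt_of_le_of_ne (by linarith) (mul_ne_zero hBt hB)
    have hsect : p.secular l (t ^ 2)
        = -(t ^ 2 / 2) * besselEntire ((l : ℝ) + 1 / 2 + 1) (t ^ 2) := by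
      rw [secular, hzt]; ring
    obtain ⟨z, hz, hz0⟩ := exists_mem_Ioo_eq_zero_of_mul_neg htv2.le
      (continuous_secular (p := p) l).continuousOn (by
        rw [hsec, hsect]
        have h1 : 0 < t ^ 2 / 2 * (p.v0 ^ 2 / 2) := by positivity
        have := mul_neg_of_pos_of_neg h1 hprod'
        linarith)
    obtain ⟨E, u, hb, hE⟩ := exists_isBoundState_of_secular_eq_zero hβ hβ' hz.2 hz0
    exact ⟨E, u, hb, fun _ => hE ((sq_nonneg t).trans_lt hz.1)⟩

end DeltaWell

theorem theorem2 (p : DeltaWell) (hβ : p.beta ≠ 2) (hβ' : p.beta ≠ -2) :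
    -- the limits `φ̂_ℓ(0⁺)` exist
    (∀ l : ℕ, Tendsto (p.phiHat l) (𝓝[>] 0) (𝓝 (p.phiHatZero l))) ∧
    -- there are no bound states with `ℓ > ℓ_max`, and none at all if the set is empty
    (∀ lmax : ℕ, IsGreatest p.admissible lmax →
      ∀ l : ℕ, lmax < l → ¬ ∃ (E : ℝ) (u : ℝ → ℂ), p.IsBoundState l E u) ∧
    (p.admissible = ∅ → ∀ l : ℕ, ¬ ∃ (E : ℝ) (u : ℝ → ℂ), p.IsBoundState l E u) ∧
    -- `ℓ_max` exists; the premise is automatic if `alpha` does not depend on `ℓ`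
    ((∃ δ : ℝ, 0 < δ ∧ ∀ᶠ l : ℕ in atTop,
        δ ≤ (p.beta - 2) ^ 2 + 2 * (l : ℝ) * (p.beta ^ 2 + 4) + p.w l) →
      p.admissible.Nonempty → ∃ lmax : ℕ, IsGreatest p.admissible lmax) ∧
    -- a bound state exists for `ℓ₀` if `v₀ = j_{ℓ₀+1/2,s₀}`
    (∀ l₀ s₀ : ℕ, 1 ≤ s₀ → p.v0 = besselZero ((l₀ : ℝ) + 1 / 2) s₀ →
      ∃ (E : ℝ) (u : ℝ → ℂ), p.IsBoundState l₀ E u ∧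
        (2 ≤ s₀ ∨ 0 < p.phiHat l₀ p.v0 → -p.V0 < E)) := by
  refine ⟨fun l => tendsto_rightLim_of_tendsto ⟨_, p.tendsto_phiHat l⟩, ?_, ?_, ?_, ?_⟩
  · exact fun lmax hmax l hl => DeltaWell.not_isBoundState_of_notMem_admissible hβ hβ'
      fun h => hl.not_ge (hmax.2 h)
  · exact fun hempty l => DeltaWell.not_isBoundState_of_notMem_admissible hβ hβ'
      (hempty ▸ notMem_empty l)
  · exact fun ⟨δ, hδ, h⟩ hne => DeltaWell.exists_isGreatest_admissible hβ hδ h hne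
  · intro l₀ s₀ hs hv
    obtain ⟨s, rfl⟩ := Nat.exists_eq_add_of_le' hs
    exact DeltaWell.exists_isBoundState_of_v0_eq_besselZero hβ hβ' l₀ s hv
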